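/- A symmetric $(v,k,\lambda)$-covering is a set $V$ of $v$ points together with a collection of $v$ blocks, each a $k$-subset of $V$, such that any two distinct points $x,y$ lie together in $r_{xy}\ge\lambda$ blocks. Its excess is the multigraph on $V$ in which the edge $xy$ has multiplicity $r_{xy}-\lambda$. Cycles have length at least $2$; a $2$-cycle is a pair of parallel edges. For $n\ge 3$ let $B_n(a)$ be the $n\times n$ matrix with diagonal entries $a$, entries $1$ in positions $(i,j)$ with $i-j\equiv\pm1 \pmod n$, and $0$ elsewhere. Let $B_2(a)=\begin{pmatrix}a&2\\2&a\end{pmatrix}$. For $n\ge 2$ put $X_{(nt,k,\lambda)}[n^t]=\mathrm{diag}(B_n(k-\lambda),\dots,B_n(k-\lambda))+\lambda J_{nt}$, with $t$ diagonal blocks, where $J_{nt}$ is the all-ones matrix. For an odd prime $p$ and nonzero integers $a=\bar a p^{\alpha}$, $b=\bar b p^{\beta}$ with $p\nmid \bar a\bar b$, put $(a,b)_p=\left(\frac{-1}{p}\right)^{\alpha\beta}\left(\frac{\bar a}{p}\right)^{\beta}\left(\frac{\bar b}{p}\right)^{\alpha}$, extended to nonzero rationals by $(as^2,bu^2)_p=(a,b)_p$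 for nonzero rationals $s,u$. For a rational $m\times m$ matrix $X$ whose leading principal minors $|X_1|,\dots,|X_m|$ are all nonzero, put $C_p(X)=(-1,-|X_m|)_p\prod_{i=1}^{m-1}(|X_i|,-|X_{i+1}|)_p$. **Theorem.** Let $n,t,k,\lambda$ be positive integers with $k>\lambda+2$, $nt=\frac{k(k-1)-2}{\lambda}+1$ and $nt$ odd. Let $p$ be an odd prime with $p\mid k-\lambda+2$ and $p\nmid n$. Write $k-\lambda+2=sp^{\alpha}$ and $\lambda=\bar\lambda p^{\gamma}$ with $p\nmid s\bar\lambda$. Consider the conditions 1. $\alpha$ is even, $\gamma$ is odd and $\left(\frac{s}{p}\right)=-1$; 2. $\alpha$ is odd, $\gamma$ is even and $\left(\frac{(-1)^{(t-1)/2}\,n\bar\lambda}{p}\right)=-1$; 3. $\alpha$ is odd, $\gamma$ is odd and $\left(\frac{(-1)^{(t+1)/2}\,ns\bar\lambda}{p}\right)=-1$. If at least one of them holds, there is no symmetric $(nt,k,\lambda)$-covering whose excess consists of $t$ vertex-disjoint cycles of length $n$ covering all points. If none of them holds and $n\ge 2$, then all leading principal minors of $X_{(nt,k,\lambda)}[n^t]$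 are nonzero and $C_p(X_{(nt,k,\lambda)}[n^t])=1$. -/

import Mathlib

/-! ### Coverings and their excesses -/

/-- The number `r_{xy}` of blocks (counted with multiplicity) that contain both `x` and `y`. -/
def pairCount {V : Type*} [DecidableEq V] (B : Multiset (Finset V)) (x y : V) : ℕ :=
  B.countP (fun b => x ∈ b ∧ y ∈ b)

/-- `(V, B)` is a symmetric `(v, k, lam)`-covering: `V` has `v` points, the blocks are `k`-subsets
of `V` (repeated blocks are allowed), there are as many blocks as points, and every pair of
distinct points lies in at least `lam` blocks. -/
structure IsSymmetricCovering {V : Type*} [Fintype V] [DecidableEq V]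
    (v k lam : ℕ) (B : Multiset (Finset V)) : Prop where
  card_points : Fintype.card V = v
  card_block : ∀ b ∈ B, b.card = k
  le_pairCount : ∀ x y : V, x ≠ y → lam ≤ pairCount B x y
  card_blocks : B.card = Fintype.card V

/-- The multiplicity `r_{xy} - lam` of the edge `xy` (for `x ≠ y`) in the excess of a
covering with blocks `B`; for coverings the subtraction does not truncate. -/
def excessMult {V : Type*} [DecidableEq V] (lam : ℕ) (B : Multiset (Finset V)) (x y : V) : ℕ :=
  pairCount B x y - lam

/-- The multiplicity of the edge `ij` (for `i ≠ j`) in the cycle `(0, 1, …, n - 1)` of length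
`n ≥ 2`, that is, the multigraph with one edge joining `l` and `l + 1` (mod `n`) for each `l`.
For `n = 2` the edge `01` has multiplicity `2`, and for `n ≥ 3` all multiplicities are at
most `1`. -/
def cycleMult (n : ℕ) (i j : Fin n) : ℕ :=
  (if (i.val + 1) % n = j.val then 1 else 0) + (if (j.val + 1) % n = i.val then 1 else 0)

/-- The excess of the covering with blocks `B` has cycle type `[c_0, …, c_{t-1}]` (all `c_i ≥ 2`):
it is the vertex-disjoint union of cycles of these lengths on the vertex set `V`. -/
def ExcessHasCycleType {V : Type*} [DecidableEq V] (lam : ℕ) (B : Multiset (Finset V))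
    {t : ℕ} (c : Fin t → ℕ) : Prop :=
  (∀ i, 2 ≤ c i) ∧
    ∃ e : ((i : Fin t) × Fin (c i)) ≃ V,
      (∀ (i : Fin t) (x y : Fin (c i)), x ≠ y →
        excessMult lam B (e ⟨i, x⟩) (e ⟨i, y⟩) = cycleMult (c i) x y) ∧
      (∀ (i j : Fin t) (x : Fin (c i)) (y : Fin (c j)), i ≠ j →
        excessMult lam B (e ⟨i, x⟩) (e ⟨j, y⟩) = 0)

/-! ### The matrix `X` of a cycle type -/

/-- The matrix `B_n(a)`, for `n ≥ 2`: diagonal entries `a`, off-diagonal entries the edge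
multiplicities of the cycle `(0, 1, …, n - 1)`. -/
def cycleMatrix (n : ℕ) (a : ℚ) : Matrix (Fin n) (Fin n) ℚ :=
  Matrix.of fun i j => if i = j then a else (cycleMult n i j : ℚ)

/-- The matrix `X_{(v,k,lam)}[c_0, …, c_{t-1}]`
`= diag(B_{c_0}(k - lam), …, B_{c_{t-1}}(k - lam)) + lam J_v`, where `v = c_0 + … + c_{t-1}`.
`finSigmaFinEquiv` numbers the rows block after block, in increasing order. -/
def excessMatrix (k lam : ℕ) {t : ℕ} (c : Fin t → ℕ) :
    Matrix (Fin (∑ i, c i)) (Fin (∑ i, c i)) ℚ :=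
  Matrix.reindex finSigmaFinEquiv finSigmaFinEquiv
      (Matrix.blockDiagonal' fun i => cycleMatrix (c i) ((k : ℚ) - (lam : ℚ)))
    + (lam : ℚ) • Matrix.of fun _ _ => 1

/-! ### Hilbert symbols and the Hasse-Minkowski invariant at an odd prime -/

/-- The Hilbert symbol `(a, b)_p` of nonzero integers `a = a' p ^ α` and `b = b' p ^ β`
(with `a'`, `b'` prime to `p`) at an odd prime `p`:
`(-1 / p) ^ (α β) * (a' / p) ^ β * (b' / p) ^ α`. -/
def hilbertSymInt (p : ℕ) [Fact p.Prime] (a b : ℤ) : ℤ :=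
  legendreSym p (-1) ^ (padicValInt p a * padicValInt p b) *
    legendreSym p (a / (p : ℤ) ^ padicValInt p a) ^ padicValInt p b *
    legendreSym p (b / (p : ℤ) ^ padicValInt p b) ^ padicValInt p a

/-- The Hilbert symbol of nonzero rationals at an odd prime. It depends only on the classes modulo
nonzero squares, and `x` and `x.num * x.den` are in the same class; for an
integer `x` they are equal. -/
def hilbertSym (p : ℕ) [Fact p.Prime] (x y : ℚ) : ℤ :=
  hilbertSymInt p (x.num * (x.den : ℤ)) (y.num * (y.den : ℤ))

/-- The determinant `|X_i|` of the submatrix in the first `i` rows and the first `i` columns. -/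
def leadingMinor {n : ℕ} (X : Matrix (Fin n) (Fin n) ℚ) (i : ℕ) : ℚ :=
  (X.toSquareBlockProp fun j => j.val < i).det

/-- All leading principal minors are nonzero. -/
def IsNondegenerateMatrix {n : ℕ} (X : Matrix (Fin n) (Fin n) ℚ) : Prop :=
  ∀ i ∈ Finset.Icc 1 n, leadingMinor X i ≠ 0

/-- The Hasse-Minkowski invariant `C_p(X)`, for an odd prime `p` and a nondegenerate rational
`n × n` matrix `X`:
`(-1, -|X_n|)_p * ∏_{i=1}^{n-1} (|X_i|, -|X_{i+1}|)_p`. -/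
def hasseMinkowski (p : ℕ) [Fact p.Prime] {n : ℕ} (X : Matrix (Fin n) (Fin n) ℚ) : ℤ :=
  hilbertSym p (-1) (-leadingMinor X n) *
    ∏ i ∈ Finset.Ico 1 n, hilbertSym p (leadingMinor X i) (-leadingMinor X (i + 1))

/-! ### The Hilbert symbol -/

section HilbertInt

variable (p : ℕ) [Fact p.Prime]

/-! For the incidence matrix `N` of such a covering, the excess matrix `X`, up to the order of the
points, is `N Nᵀ`. As `N` is square, `X` is rationally congruent to the identity, so its
Hasse-Minkowski invariant is 1 (`hasseMinkowski_eq_one_of_covering`). The theorem thus amounts to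
computing `C_p(X)` and comparing it with the three conditions.

The invariant is preserved by congruence of anisotropic matrices
(`hasseMinkowski_transpose_mul_mul`), so a convenient basis may be chosen. On each cycle the
all-ones vector is an eigenvector of the circulant block with eigenvalue `k - λ + 2`, orthogonal to
the vectors of coordinate sum zero. Hence `X` is congruent to the orthogonal sum of `t` copies of
the form on the sum-zero lattice and of `n (k - λ + 2) I + λ n² J` on the `t` all-ones vectors
(`matrixCongruent_shiftBlockMatrix_directSumMatrix`).

Modulo `p` the circulant block is `-2 I + S + Sᵀ = -(1 - S)ᵀ(1 - S)`, `S` being the cyclic shift.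
With `p ∤ n` and `n` odd, the sum-zero form therefore has determinant prime to `p` and equal to `n`
modulo squares in `𝔽_p` (`exists_dvd_det_sumZeroGram`). Over `𝔽_p` with `p` odd it can be
diagonalized, so it enters the invariant only through its determinant
(`hasseMinkowski_directSumMatrix`). The minors of `c I + e J` are explicit and their symbols
telescope (`prod_hilbertSym_scalarAddConstMinor`).

Together, with `t = 2 r + 1`, this gives `C_p(X) = (k - λ + 2, (-1)^r n λ)_p`. The three conditions
list exactly the parities of `α` and `γ` and the Legendre symbols for which it is -1. -/

theorem legendreSym_sq_eq_one {a : ℤ} (ha : ¬ (p : ℤ) ∣ a) : legendreSym p a ^ 2 = 1 :=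
  legendreSym.sq_one p (by rwa [Ne, ZMod.intCast_zmod_eq_zero_iff_dvd])

theorem exists_eq_pow_mul_not_dvd {a : ℤ} (ha : a ≠ 0) :
    ∃ (m : ℕ) (u : ℤ), a = (p : ℤ) ^ m * u ∧ ¬ (p : ℤ) ∣ u := by
  have hp : Prime (p : ℤ) := Nat.prime_iff_prime_int.mp Fact.out
  obtain ⟨u, hu⟩ := (FiniteMultiplicity.of_prime_left hp ha).exists_eq_pow_mul_and_not_dvd
  exact ⟨_, u, hu⟩

theorem pow_two_mul_eq_one {x : ℤ} (h : x ^ 2 = 1) (m : ℕ) : x ^ (2 * m) = 1 := by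
  rw [pow_mul, h, one_pow]

theorem padicValInt_pow_mul (m : ℕ) {u : ℤ} (hu : ¬ (p : ℤ) ∣ u) :
    padicValInt p ((p : ℤ) ^ m * u) = m := by
  have hp := Fact.out (p := p.Prime)
  have hu0 : u ≠ 0 := by rintro rfl; simp at hu
  rw [padicValInt.mul (by simp [hp.ne_zero]) hu0, padicValInt.eq_zero_of_not_dvd hu]
  simp [padicValInt, Int.natAbs_pow]

theorem hilbertSymInt_pow_mul (m l : ℕ) {u w : ℤ} (hu : ¬ (p : ℤ) ∣ u) (hw : ¬ (p : ℤ) ∣ w) :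
    hilbertSymInt p ((p : ℤ) ^ m * u) ((p : ℤ) ^ l * w) =
      legendreSym p (-1) ^ (m * l) * legendreSym p u ^ l * legendreSym p w ^ m := by
  have hp : (p : ℤ) ≠ 0 := by exact_mod_cast (Fact.out (p := p.Prime)).ne_zero
  rw [hilbertSymInt, padicValInt_pow_mul p m hu, padicValInt_pow_mul p l hw,
    Int.mul_ediv_cancel_left _ (pow_ne_zero _ hp), Int.mul_ediv_cancel_left _ (pow_ne_zero _ hp)]

theorem not_dvd_mul {u w : ℤ} (hu : ¬ (p : ℤ) ∣ u) (hw : ¬ (p : ℤ) ∣ w) : ¬ (p : ℤ) ∣ u * w :=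
  (Nat.prime_iff_prime_int.mp Fact.out).not_dvd_mul hu hw

theorem not_dvd_neg_one : ¬ (p : ℤ) ∣ -1 := by
  have := (Nat.prime_iff_prime_int.mp (Fact.out (p := p.Prime))).not_dvd_one
  rwa [Int.dvd_neg]

theorem hilbertSymInt_comm (a b : ℤ) : hilbertSymInt p a b = hilbertSymInt p b a := by
  simp only [hilbertSymInt, mul_comm (padicValInt p a)]; ring

theorem hilbertSymInt_mul_left {a b c : ℤ} (ha : a ≠ 0) (hb : b ≠ 0) (hc : c ≠ 0) :
    hilbertSymInt p (a * b) c = hilbertSymInt p a c * hilbertSymInt p b c := by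
  obtain ⟨m, u, rfl, hu⟩ := exists_eq_pow_mul_not_dvd p ha
  obtain ⟨l, w, rfl, hw⟩ := exists_eq_pow_mul_not_dvd p hb
  obtain ⟨r, z, rfl, hz⟩ := exists_eq_pow_mul_not_dvd p hc
  have e : (p : ℤ) ^ m * u * ((p : ℤ) ^ l * w) = (p : ℤ) ^ (m + l) * (u * w) := by ring
  rw [e, hilbertSymInt_pow_mul p _ _ (not_dvd_mul p hu hw) hz, hilbertSymInt_pow_mul p _ _ hu hz,
    hilbertSymInt_pow_mul p _ _ hw hz, legendreSym.mul]
  ring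

theorem hilbertSymInt_sq {a b : ℤ} (ha : a ≠ 0) (hb : b ≠ 0) : hilbertSymInt p a b ^ 2 = 1 := by
  obtain ⟨m, u, rfl, hu⟩ := exists_eq_pow_mul_not_dvd p ha
  obtain ⟨l, w, rfl, hw⟩ := exists_eq_pow_mul_not_dvd p hb
  rw [hilbertSymInt_pow_mul p _ _ hu hw, mul_pow, mul_pow, pow_right_comm, pow_right_comm _ l,
    pow_right_comm _ m, legendreSym_sq_eq_one p hu, legendreSym_sq_eq_one p hw,
    legendreSym_sq_eq_one p (not_dvd_neg_one p)]
  simp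

theorem legendreSym_congr {a b : ℤ} (h : (p : ℤ) ∣ a - b) : legendreSym p a = legendreSym p b := by
  have h' : a % p = b % p := Int.ModEq.symm ((Int.modEq_iff_dvd).mpr h)
  rw [legendreSym.mod p a, legendreSym.mod p b, h']

/-- This is the source of every nontrivial symbol identity below. If the valuations of `a` and `b`
differ, the smaller one is that of `f ^ 2`, hence even, and the corresponding unit is a square
modulo `p`. If they are equal and odd, `p` must divide the sum of the two units. The case `f = 0` is
included and yields `(x, -x) = 1`. -/
theorem hilbertSymInt_eq_one_of_add_eq_sq {a b f : ℤ} (ha : a ≠ 0) (hb : b ≠ 0)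
    (h : a + b = f ^ 2) : hilbertSymInt p a b = 1 := by
  have hp := Fact.out (p := p.Prime)
  have hpp : Prime (p : ℤ) := Nat.prime_iff_prime_int.mp hp
  have key : ∀ {m l : ℕ} {u w : ℤ}, m < l → ¬ (p : ℤ) ∣ u →
      (p : ℤ) ^ m * u + (p : ℤ) ^ l * w = f ^ 2 → Even m ∧ legendreSym p u = 1 := by
    intro m l u w hml hu h
    obtain ⟨d, rfl⟩ := Nat.exists_eq_add_of_lt hml
    have hne : ¬ (p : ℤ) ∣ (u + (p : ℤ) ^ (d + 1) * w) := fun hd =>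
      hu ((Int.dvd_add_left (Dvd.dvd.mul_right (dvd_pow_self _ (by omega)) _)).mp hd)
    have h' : (p : ℤ) ^ m * (u + (p : ℤ) ^ (d + 1) * w) = f ^ 2 := by rw [← h]; ring
    have hf : f ≠ 0 := by
      rintro rfl
      simp [hp.ne_zero] at h'
      exact hne (h' ▸ dvd_zero _)
    obtain ⟨r, z, rfl, hz⟩ := exists_eq_pow_mul_not_dvd p hf
    have h2 : ((p : ℤ) ^ r * z) ^ 2 = (p : ℤ) ^ (2 * r) * z ^ 2 := by ring
    have hz2 : ¬ (p : ℤ) ∣ z ^ 2 := by rw [sq]; exact not_dvd_mul p hz hz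
    rw [h2] at h'
    have hm : m = 2 * r := by
      rw [← padicValInt_pow_mul p m hne, h', padicValInt_pow_mul p _ hz2]
    subst hm
    refine ⟨even_two_mul r, ?_⟩
    have h3 := mul_left_cancel₀ (pow_ne_zero _ hpp.ne_zero) h'
    rw [legendreSym_congr p (b := z ^ 2), sq, legendreSym.mul, ← sq, legendreSym_sq_eq_one p hz]
    rw [← h3]
    ring_nf
    exact ⟨-((p : ℤ) ^ d * w), by ring⟩
  obtain ⟨m, u, rfl, hu⟩ := exists_eq_pow_mul_not_dvd p ha
  obtain ⟨l, w, rfl, hw⟩ := exists_eq_pow_mul_not_dvd p hb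
  rcases lt_trichotomy m l with hml | rfl | hml
  · obtain ⟨⟨r, rfl⟩, h1⟩ := key hml hu h
    rw [hilbertSymInt_pow_mul p _ _ hu hw, h1]
    have := legendreSym_sq_eq_one p hw
    have h4 := legendreSym_sq_eq_one p (not_dvd_neg_one p)
    rw [show (r + r) * l = 2 * (r * l) by ring, ← two_mul, pow_two_mul_eq_one this,
      pow_two_mul_eq_one h4]
    simp
  · rw [hilbertSymInt_pow_mul p _ _ hu hw]
    have h1 := legendreSym_sq_eq_one p hw
    have h2 := legendreSym_sq_eq_one p hu
    have h4 := legendreSym_sq_eq_one p (not_dvd_neg_one p)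
    rcases Nat.even_or_odd m with ⟨r, rfl⟩ | ⟨r, rfl⟩
    · rw [show (r + r) * (r + r) = 2 * (2 * (r * r)) by ring, ← two_mul, pow_two_mul_eq_one h1,
        pow_two_mul_eq_one h2, pow_two_mul_eq_one h4]
      simp
    · have hd : (p : ℤ) ∣ w - -1 * u := by
        have h5 : (p : ℤ) ^ (2 * r + 1) ∣ f ^ 2 := ⟨u + w, by rw [← h]; ring⟩
        -- A nonzero square has even valuation, so the odd power dividing `f ^ 2` can be raised by
        -- one.
        have h6 : (p : ℤ) ^ (2 * r + 2) ∣ f ^ 2 := by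
          by_cases hf : f = 0
          · simp [hf]
          obtain ⟨q, z, rfl, hz⟩ := exists_eq_pow_mul_not_dvd p hf
          have hz2 : ¬ (p : ℤ) ∣ z ^ 2 := by rw [sq]; exact not_dvd_mul p hz hz
          rw [mul_pow, ← pow_mul] at h5 ⊢
          have : 2 * r + 1 ≤ q * 2 := by
            by_contra hlt
            push Not at hlt
            obtain ⟨d, hd⟩ := Nat.exists_eq_add_of_lt hlt
            rw [hd, add_assoc, pow_add, mul_dvd_mul_iff_left (pow_ne_zero _ hpp.ne_zero)] at h5
            exact hz2 ((dvd_pow_self _ (by omega)).trans h5)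
          exact Dvd.dvd.mul_right (pow_dvd_pow _ (by omega)) _
        rw [← h, ← mul_add, pow_succ _ (2 * r + 1),
          mul_dvd_mul_iff_left (pow_ne_zero _ hpp.ne_zero)] at h6
        rwa [neg_one_mul, sub_neg_eq_add, add_comm]
      rw [legendreSym_congr p hd, legendreSym.mul]
      generalize legendreSym p (-1) = x at *
      generalize legendreSym p u = y at *
      calc _ = (x ^ 2) ^ (2 * r ^ 2 + 3 * r + 1) * (y ^ 2) ^ (2 * r + 1) := by ring
        _ = 1 := by rw [h4, h2]; simp
  · rw [add_comm] at h
    obtain ⟨⟨r, rfl⟩, h1⟩ := key hml hw h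
    rw [hilbertSymInt_pow_mul p _ _ hu hw, h1]
    have := legendreSym_sq_eq_one p hu
    have h4 := legendreSym_sq_eq_one p (not_dvd_neg_one p)
    rw [show m * (r + r) = 2 * (m * r) by ring, ← two_mul, pow_two_mul_eq_one this,
      pow_two_mul_eq_one h4]
    simp

end HilbertInt

/-! ### The Hilbert symbol on nonzero rationals -/

section HilbertRat

variable (p : ℕ) [Fact p.Prime]

theorem hilbertSymInt_congr_left {a a' b m : ℤ} (ha : a ≠ 0) (ha' : a' ≠ 0) (hb : b ≠ 0)
    (h : a * a' = m ^ 2) : hilbertSymInt p a b = hilbertSymInt p a' b := by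
  have hm : m ≠ 0 := by rintro rfl; simp [ha, ha'] at h
  have h1 : hilbertSymInt p a b * hilbertSymInt p a' b = 1 := by
    rw [← hilbertSymInt_mul_left p ha ha' hb, h, sq, hilbertSymInt_mul_left p hm hm hb, ← sq,
      hilbertSymInt_sq p hm hb]
  have h2 := hilbertSymInt_sq p ha' hb
  calc _ = hilbertSymInt p a b * hilbertSymInt p a' b ^ 2 := by rw [h2, mul_one]
    _ = _ := by rw [sq, ← mul_assoc, h1, one_mul]

theorem num_mul_den_ne_zero {x : ℚ} (hx : x ≠ 0) : x.num * (x.den : ℤ) ≠ 0 := by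
  simp [hx]

theorem hilbertSym_comm (x y : ℚ) : hilbertSym p x y = hilbertSym p y x :=
  hilbertSymInt_comm p _ _

/-- The symbol sees only the square class, so any integer in the class of `x` may replace `x.num *
x.den`. -/
theorem hilbertSym_eq_of_left {x y s : ℚ} {a : ℤ} (hx : x ≠ 0) (hy : y ≠ 0)
    (h : (a : ℚ) = x * s ^ 2) (hs : s ≠ 0) :
    hilbertSym p x y = hilbertSymInt p a (y.num * (y.den : ℤ)) := by
  have ha : a ≠ 0 := by
    have : (a : ℚ) ≠ 0 := by rw [h]; positivity
    exact_mod_cast this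
  have hsq : IsSquare (((x.num * (x.den : ℤ) * a : ℤ)) : ℚ) := by
    refine ⟨x * s * x.den, ?_⟩
    push_cast
    rw [h]
    have := Rat.mul_den_eq_num x
    rw [← this]; ring
  rw [Rat.isSquare_intCast_iff] at hsq
  obtain ⟨m, hm⟩ := hsq
  exact hilbertSymInt_congr_left p (num_mul_den_ne_zero hx) ha (num_mul_den_ne_zero hy)
    (m := m) (by rw [hm, sq])

theorem hilbertSym_intCast (a b : ℤ) :
    hilbertSym p a b = hilbertSymInt p a b := by
  simp [hilbertSym]

theorem hilbertSym_sq {x y : ℚ} (hx : x ≠ 0) (hy : y ≠ 0) : hilbertSym p x y ^ 2 = 1 :=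
  hilbertSymInt_sq p (num_mul_den_ne_zero hx) (num_mul_den_ne_zero hy)

theorem coe_num_mul_den (x : ℚ) : ((x.num * (x.den : ℤ) : ℤ) : ℚ) = x * (x.den : ℚ) ^ 2 := by
  have := Rat.mul_den_eq_num x
  push_cast
  rw [← this]; ring

theorem hilbertSym_mul_left {x y z : ℚ} (hx : x ≠ 0) (hy : y ≠ 0) (hz : z ≠ 0) :
    hilbertSym p (x * y) z = hilbertSym p x z * hilbertSym p y z := by
  rw [hilbertSym_eq_of_left p (s := x.den * y.den)
    (a := (x.num * (x.den : ℤ)) * (y.num * (y.den : ℤ))) (mul_ne_zero hx hy) hz _ (by simp),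
    hilbertSymInt_mul_left p (num_mul_den_ne_zero hx) (num_mul_den_ne_zero hy)
      (num_mul_den_ne_zero hz)]
  · rfl
  · rw [Int.cast_mul, coe_num_mul_den, coe_num_mul_den]; ring

theorem hilbertSym_mul_right {x y z : ℚ} (hx : x ≠ 0) (hy : y ≠ 0) (hz : z ≠ 0) :
    hilbertSym p z (x * y) = hilbertSym p z x * hilbertSym p z y := by
  rw [hilbertSym_comm, hilbertSym_mul_left p hx hy hz, hilbertSym_comm p x, hilbertSym_comm p y]

theorem hilbertSym_sq_left {x y : ℚ} (hx : x ≠ 0) (hy : y ≠ 0) : hilbertSym p (x ^ 2) y = 1 := by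
  rw [sq, hilbertSym_mul_left p hx hx hy, ← sq, hilbertSym_sq p hx hy]

theorem hilbertSym_mul_sq_left {x y s : ℚ} (hx : x ≠ 0) (hy : y ≠ 0) (hs : s ≠ 0) :
    hilbertSym p (x * s ^ 2) y = hilbertSym p x y := by
  rw [hilbertSym_mul_left p hx (by positivity) hy, hilbertSym_sq_left p hs hy, mul_one]

theorem hilbertSym_mul_sq_right {x y s : ℚ} (hx : x ≠ 0) (hy : y ≠ 0) (hs : s ≠ 0) :
    hilbertSym p y (x * s ^ 2) = hilbertSym p y x := by
  rw [hilbertSym_comm, hilbertSym_mul_sq_left p hx hy hs, hilbertSym_comm]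

theorem hilbertSym_one_left {y : ℚ} (hy : y ≠ 0) : hilbertSym p 1 y = 1 := by
  simpa using hilbertSym_sq_left p one_ne_zero hy

theorem hilbertSym_eq_one_of_add_eq_sq {x y f : ℚ} (hx : x ≠ 0) (hy : y ≠ 0)
    (h : x + y = f ^ 2) : hilbertSym p x y = 1 := by
  set s : ℚ := x.den * y.den * f.den with hs
  have hs0 : s ≠ 0 := by simp [hs]
  have ex := Rat.mul_den_eq_num x
  have ey := Rat.mul_den_eq_num y
  have ef := Rat.mul_den_eq_num f
  have e1 : ((x.num * x.den * (y.den * f.den) ^ 2 : ℤ) : ℚ) = x * s ^ 2 := by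
    push_cast; rw [← ex, hs]; ring
  have e2 : ((y.num * y.den * (x.den * f.den) ^ 2 : ℤ) : ℚ) = y * s ^ 2 := by
    push_cast; rw [← ey, hs]; ring
  have e3 : ((f.num * (x.den * y.den) : ℤ) : ℚ) = f * s := by
    push_cast; rw [← ef, hs]; ring
  rw [← hilbertSym_mul_sq_left p hx hy hs0, ← hilbertSym_mul_sq_right p hy _ hs0, ← e1, ← e2,
    hilbertSym_intCast]
  · refine hilbertSymInt_eq_one_of_add_eq_sq p (f := f.num * (x.den * y.den)) ?_ ?_ ?_
    · simp [hx]
    · simp [hy]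
    · have : (((x.num * x.den * (y.den * f.den) ^ 2 + y.num * y.den * (x.den * f.den) ^ 2 : ℤ)) : ℚ)
          = (((f.num * (x.den * y.den)) ^ 2 : ℤ) : ℚ) := by
        rw [Int.cast_add, Int.cast_pow, e1, e2, e3, ← add_mul, h, ← mul_pow]
      exact_mod_cast this
  · exact mul_ne_zero hx (pow_ne_zero _ hs0)

theorem hilbertSym_self_neg {x : ℚ} (hx : x ≠ 0) : hilbertSym p x (-x) = 1 :=
  hilbertSym_eq_one_of_add_eq_sq p (f := 0) hx (neg_ne_zero.mpr hx) (by simp)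

theorem hilbertSym_eq_one_of_not_dvd {a b : ℤ} (ha : ¬ (p : ℤ) ∣ a) (hb : ¬ (p : ℤ) ∣ b) :
    hilbertSym p a b = 1 := by
  have h := hilbertSymInt_pow_mul p 0 0 ha hb
  rw [hilbertSym_intCast]
  simpa using h

/-- Against any `x`, a `p`-adic unit acts only through its Legendre symbol. This later replaces the
determinant of the sum-zero form by `n`. -/
theorem hilbertSym_congr_of_dvd {a b c : ℤ} {x : ℚ} (hx : x ≠ 0) (ha : ¬ (p : ℤ) ∣ a)
    (hb : ¬ (p : ℤ) ∣ b) (h : (p : ℤ) ∣ a * b - c ^ 2) : hilbertSym p a x = hilbertSym p b x := by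
  have hpp : Prime (p : ℤ) := Nat.prime_iff_prime_int.mp Fact.out
  have hc : ¬ (p : ℤ) ∣ c := fun hc => not_dvd_mul p ha hb
    ((Int.dvd_iff_dvd_of_dvd_sub h).mpr (hc.trans (dvd_pow_self _ two_ne_zero)))
  have ha0 : a ≠ 0 := by rintro rfl; simp at ha
  have hb0 : b ≠ 0 := by rintro rfl; simp at hb
  have hl : legendreSym p a = legendreSym p b := by
    have h1 : legendreSym p a * legendreSym p b = 1 := by
      rw [← legendreSym.mul, legendreSym_congr p h, sq, legendreSym.mul, ← sq,
        legendreSym_sq_eq_one p hc]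
    have h2 := legendreSym_sq_eq_one p hb
    calc _ = legendreSym p a * legendreSym p b ^ 2 := by rw [h2, mul_one]
      _ = _ := by rw [sq, ← mul_assoc, h1, one_mul]
  have e : ∀ u : ℤ, ¬ (p : ℤ) ∣ u → ∀ (m : ℕ) (w : ℤ), ¬ (p : ℤ) ∣ w →
      hilbertSymInt p u ((p : ℤ) ^ m * w) = legendreSym p u ^ m := by
    intro u hu m w hw
    simpa using hilbertSymInt_pow_mul p 0 m hu hw
  obtain ⟨m, w, hmw, hw⟩ := exists_eq_pow_mul_not_dvd p (num_mul_den_ne_zero hx)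
  simp only [hilbertSym, hmw, Rat.num_intCast, Rat.den_intCast, Nat.cast_one, mul_one]
  rw [e a ha m w hw, e b hb m w hw, hl]

end HilbertRat

/-! ### Anisotropic symmetric matrices and congruence -/

/-- A symmetric rational matrix whose quadratic form has no nontrivial zero. -/
structure IsAnisotropicMatrix {ι : Type*} [Fintype ι] (X : Matrix ι ι ℚ) : Prop where
  isSymm : X.IsSymm
  eq_zero : ∀ x : ι → ℚ, x ⬝ᵥ X.mulVec x = 0 → x = 0

namespace IsAnisotropicMatrix

variable {ι κ : Type*} [Fintype ι] [Fintype κ] {X : Matrix ι ι ℚ}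

theorem det_ne_zero [DecidableEq ι] (hX : IsAnisotropicMatrix X) : X.det ≠ 0 := by
  intro h
  obtain ⟨x, hx, h⟩ := Matrix.exists_mulVec_eq_zero_iff.mpr h
  exact hx (hX.eq_zero x (by rw [h, dotProduct_zero]))

theorem transpose_mul_mul (hX : IsAnisotropicMatrix X) (P : Matrix ι κ ℚ)
    (hP : ∀ x, P.mulVec x = 0 → x = 0) : IsAnisotropicMatrix (P.transpose * X * P) where
  isSymm := by
    rw [Matrix.IsSymm, Matrix.transpose_mul, Matrix.transpose_mul, Matrix.transpose_transpose,
      hX.isSymm.eq, Matrix.mul_assoc]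
  eq_zero x hx := by
    apply hP
    apply hX.eq_zero
    rw [← hx, Matrix.mul_assoc, ← Matrix.mulVec_mulVec, ← Matrix.mulVec_mulVec,
      Matrix.dotProduct_mulVec x, Matrix.vecMul_transpose]

theorem submatrix (hX : IsAnisotropicMatrix X) {f : κ → ι} (hf : Function.Injective f) :
    IsAnisotropicMatrix (X.submatrix f f) := by
  classical
  have e : X.submatrix f f =
      ((1 : Matrix ι ι ℚ).submatrix id f).transpose * X * (1 : Matrix ι ι ℚ).submatrix id f := by
    ext i j
    simp [Matrix.mul_apply, Matrix.one_apply]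
  rw [e]
  refine hX.transpose_mul_mul _ fun x hx => ?_
  ext k
  have := congrFun hx (f k)
  simpa [Matrix.mulVec, dotProduct, Matrix.one_apply, hf.eq_iff] using this

/-- Having nonzero leading minors is not stable under reordering or change of basis, whereas
anisotropy is; it therefore keeps every intermediate symbol well defined. -/
theorem leadingMinor_ne_zero {n : ℕ} {X : Matrix (Fin n) (Fin n) ℚ} (hX : IsAnisotropicMatrix X)
    (i : ℕ) : leadingMinor X i ≠ 0 :=
  (hX.submatrix Subtype.val_injective).det_ne_zero

end IsAnisotropicMatrix

/-! ### Leading minors: reindexing, triangular congruence, bordered minors -/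

theorem leadingMinor_eq_det_submatrix {n : ℕ} {κ : Type*} [Fintype κ] [DecidableEq κ]
    (X : Matrix (Fin n) (Fin n) ℚ) (i : ℕ) (g : κ → Fin n) (hg : Function.Injective g)
    (hr : ∀ j : Fin n, j.val < i ↔ ∃ k, g k = j) :
    leadingMinor X i = (X.submatrix g g).det := by
  let e : κ ≃ {j : Fin n // j.val < i} :=
    Equiv.ofBijective (fun k => ⟨g k, (hr _).mpr ⟨k, rfl⟩⟩)
      ⟨fun a b h => hg (congrArg Subtype.val h), fun ⟨j, hj⟩ => by
        obtain ⟨k, hk⟩ := (hr j).mp hj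
        exact ⟨k, Subtype.ext hk⟩⟩
  rw [leadingMinor, ← Matrix.det_submatrix_equiv_self e]
  rfl

theorem leadingMinor_zero {n : ℕ} (X : Matrix (Fin n) (Fin n) ℚ) : leadingMinor X 0 = 1 := by
  rw [leadingMinor_eq_det_submatrix X 0 (Fin.elim0 : Fin 0 → Fin n) (fun i => i.elim0) (by simp)]
  simp

theorem sum_eq_sum_subtype {ι : Type*} [Fintype ι] {q : ι → Prop} [DecidablePred q] {f : ι → ℚ}
    (h : ∀ i, ¬ q i → f i = 0) : ∑ i, f i = ∑ i : {i // q i}, f i := by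
  rw [← Finset.sum_filter_of_ne (p := q) (fun i _ hi => by_contra fun hq => hi (h i hq))]
  exact Finset.sum_subtype _ (by simp) f

/-- An upper triangular `P` maps the span of the first `m` basis vectors to itself, so the leading
blocks multiply separately. -/
theorem leadingMinor_transpose_mul_mul {n : ℕ} (X P : Matrix (Fin n) (Fin n) ℚ)
    (hP : ∀ i j, j < i → P i j = 0) (m : ℕ) :
    leadingMinor (P.transpose * X * P) m = leadingMinor X m * leadingMinor P m ^ 2 := by
  set q : Fin n → Prop := fun j => j.val < m
  have hP' : ∀ i j, ¬ q i → q j → P i j = 0 := fun i j hi hj =>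
    hP i j (Fin.lt_def.mpr (lt_of_lt_of_le hj (not_lt.mp hi)))
  have e : (P.transpose * X * P).toSquareBlockProp q =
      (P.toSquareBlockProp q).transpose * X.toSquareBlockProp q * P.toSquareBlockProp q := by
    ext ⟨i, hi⟩ ⟨j, hj⟩
    simp only [Matrix.toSquareBlockProp_def, Matrix.mul_apply, Matrix.of_apply,
      Matrix.transpose_apply]
    rw [sum_eq_sum_subtype (q := q) (fun k hk => by rw [hP' k j hk hj, mul_zero])]
    refine Finset.sum_congr rfl fun k _ => ?_
    rw [sum_eq_sum_subtype (q := q) (fun l hl => by rw [hP' l i hl hi, zero_mul])]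
  rw [leadingMinor, e, Matrix.det_mul, Matrix.det_mul, Matrix.det_transpose, leadingMinor,
    leadingMinor]
  ring

/-- Sylvester's identity for bordered minors. Each bordered minor is the inner minor times a minor
of the Schur complement, and symmetry of the Schur complement turns the product of its off-diagonal
entries into a square. -/
theorem exists_det_submatrix_mul_eq {ι κ : Type*} [Fintype κ] [DecidableEq κ]
    {X : Matrix ι ι ℚ} (hX : X.IsSymm) (g : κ → ι) (a b : ι) (h : (X.submatrix g g).det ≠ 0) :
    ∃ f : ℚ, (X.submatrix (Sum.elim g fun _ : Unit => a) (Sum.elim g fun _ : Unit => a)).det *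
      (X.submatrix (Sum.elim g fun _ : Unit => b) (Sum.elim g fun _ : Unit => b)).det =
      (X.submatrix g g).det *
        (X.submatrix (Sum.elim g ![a, b]) (Sum.elim g ![a, b])).det + f ^ 2 := by
  have key : ∀ {τ : Type} [Fintype τ] [DecidableEq τ] (u : τ → ι),
      (X.submatrix (Sum.elim g u) (Sum.elim g u)).det = (X.submatrix g g).det *
        (X.submatrix u u - X.submatrix u g * (X.submatrix g g)⁻¹ * X.submatrix g u).det := by
    intro τ _ _ u
    have e : X.submatrix (Sum.elim g u) (Sum.elim g u) = Matrix.fromBlocks (X.submatrix g g)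
        (X.submatrix g u) (X.submatrix u g) (X.submatrix u u) := by
      ext (i | i) (j | j) <;> rfl
    have := Matrix.invertibleOfIsUnitDet _ (isUnit_iff_ne_zero.mpr h)
    rw [e, Matrix.det_fromBlocks₁₁, Matrix.invOf_eq_nonsing_inv]
  -- Entries of the Schur complement of the block indexed by `g`.
  set S : ι → ι → ℚ := fun i j => X i j - ∑ l, (∑ k, X i (g k) * (X.submatrix g g)⁻¹ k l) * X (g l) j
  have hS : ∀ i j, S i j = S j i := by
    intro i j
    have hinv : ((X.submatrix g g)⁻¹).IsSymm := by
      rw [Matrix.IsSymm, Matrix.transpose_nonsing_inv, (hX.submatrix g).eq]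
    simp only [S, hX.apply i j, Finset.sum_mul]
    rw [Finset.sum_comm]
    congr 1
    refine Finset.sum_congr rfl fun k _ => Finset.sum_congr rfl fun l _ => ?_
    rw [hinv.apply, hX.apply i (g k), hX.apply (g l) j]; ring
  rw [key, key, key]
  refine ⟨(X.submatrix g g).det * S a b, ?_⟩
  generalize (X.submatrix g g).det = D
  rw [Matrix.det_unique (n := Unit), Matrix.det_unique (n := Unit), Matrix.det_fin_two]
  simp only [Matrix.sub_apply, Matrix.mul_apply, Matrix.submatrix_apply, Matrix.cons_val_zero,
    Matrix.cons_val_one, Matrix.cons_val_fin_one]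
  change _ * S a a * (_ * S b b) = _ * (_ * (S a a * S b b - S a b * S b a)) + _
  rw [hS b a]; ring

/-! ### Invariance of the Hasse-Minkowski invariant -/

section Invariance

variable (p : ℕ) [Fact p.Prime]

/-- The added factor with index 0 is `(1, ·) = 1`. With it, a swap of the first two rows needs no
separate treatment. -/
theorem hasseMinkowski_eq_prod_range {n : ℕ} {X : Matrix (Fin n) (Fin n) ℚ}
    (hX : IsAnisotropicMatrix X) :
    hasseMinkowski p X = hilbertSym p (-1) (-leadingMinor X n) *
      ∏ i ∈ Finset.range n, hilbertSym p (leadingMinor X i) (-leadingMinor X (i + 1)) := by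
  rw [hasseMinkowski]
  congr 1
  rcases Nat.eq_zero_or_pos n with rfl | hn
  · rfl
  rw [Finset.range_eq_Ico, Finset.prod_eq_prod_Ico_succ_bot hn, leadingMinor_zero,
    hilbertSym_one_left p (neg_ne_zero.mpr (hX.leadingMinor_ne_zero _)), one_mul]

theorem hasseMinkowski_eq_of_mul_sq {n : ℕ} {X Y : Matrix (Fin n) (Fin n) ℚ}
    (hX : IsAnisotropicMatrix X) (s : ℕ → ℚ) (hs : ∀ i, s i ≠ 0)
    (h : ∀ i, leadingMinor Y i = leadingMinor X i * s i ^ 2) :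
    hasseMinkowski p Y = hasseMinkowski p X := by
  have hd := hX.leadingMinor_ne_zero
  have e : ∀ i, -leadingMinor Y i = -leadingMinor X i * s i ^ 2 := fun i => by rw [h]; ring
  simp only [hasseMinkowski, e]
  rw [hilbertSym_mul_sq_right p (neg_ne_zero.mpr (hd _)) (by norm_num) (hs _)]
  congr 1
  refine Finset.prod_congr rfl fun i _ => ?_
  rw [h, hilbertSym_mul_sq_left p (hd i)
    (mul_ne_zero (neg_ne_zero.mpr (hd _)) (pow_ne_zero _ (hs _))) (hs i),
    hilbertSym_mul_sq_right p (neg_ne_zero.mpr (hd _)) (hd i) (hs _)]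

theorem hasseMinkowski_transpose_mul_mul_of_upper {n : ℕ} {X P : Matrix (Fin n) (Fin n) ℚ}
    (hX : IsAnisotropicMatrix X) (hP : ∀ i j, j < i → P i j = 0) (hd : P.det ≠ 0) :
    hasseMinkowski p (P.transpose * X * P) = hasseMinkowski p X := by
  have hA := hX.transpose_mul_mul P fun x hx => by_contra fun h0 =>
    hd (Matrix.exists_mulVec_eq_zero_iff.mp ⟨x, h0, hx⟩)
  refine hasseMinkowski_eq_of_mul_sq p hX (leadingMinor P) (fun i h => ?_)
    (leadingMinor_transpose_mul_mul X P hP)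
  -- The minors of `P` are nonzero because those of the anisotropic matrix `Pᵀ X P` are.
  have := hA.leadingMinor_ne_zero i
  rw [leadingMinor_transpose_mul_mul X P hP, h] at this
  simp at this

/-- Here `d, e, d'` are consecutive minors and `e'` is the middle one after a swap. Each side equals
`(d, -1)` times `(e, -d d')`, respectively `(e', -d d')`, and these agree since `e e' - d d'` is a
square. -/
theorem hilbertSym_mul_hilbertSym_eq {d e e' d' f : ℚ} (hd : d ≠ 0) (he : e ≠ 0) (he' : e' ≠ 0)
    (hd' : d' ≠ 0) (h : e * e' = d * d' + f ^ 2) :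
    hilbertSym p d (-e) * hilbertSym p e (-d') = hilbertSym p d (-e') * hilbertSym p e' (-d') := by
  have h1 : ∀ e, e ≠ 0 → hilbertSym p d (-e) * hilbertSym p e (-d') =
      hilbertSym p d (-1) * hilbertSym p e (-(d * d')) := by
    intro e he
    rw [← neg_one_mul e, hilbertSym_mul_right p (by norm_num) he hd, ← mul_neg,
      hilbertSym_mul_right p hd (neg_ne_zero.mpr hd') he, hilbertSym_comm p d e, mul_assoc]
  have h2 : hilbertSym p (e * e') (-(d * d')) = 1 :=
    hilbertSym_eq_one_of_add_eq_sq p (f := f) (mul_ne_zero he he')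
      (neg_ne_zero.mpr (mul_ne_zero hd hd')) (by rw [h]; ring)
  rw [h1 e he, h1 e' he']
  rw [hilbertSym_mul_left p he he' (neg_ne_zero.mpr (mul_ne_zero hd hd'))] at h2
  have h3 := hilbertSym_sq p he' (neg_ne_zero.mpr (mul_ne_zero hd hd'))
  congr 1
  calc _ = hilbertSym p e (-(d * d')) * hilbertSym p e' (-(d * d')) ^ 2 := by rw [h3, mul_one]
    _ = _ := by rw [sq, ← mul_assoc, h2, one_mul]

/-- Only the minor of order `i + 1` changes. It is not the full determinant, and it occurs in just
two neighbouring factors, whose product is preserved by Sylvester's identity. -/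
theorem hasseMinkowski_submatrix_swap {n : ℕ} {X : Matrix (Fin (n + 1)) (Fin (n + 1)) ℚ}
    (hX : IsAnisotropicMatrix X) (i : Fin n) :
    hasseMinkowski p (X.submatrix (Equiv.swap i.castSucc i.succ) (Equiv.swap i.castSucc i.succ)) =
      hasseMinkowski p X := by
  set σ := Equiv.swap i.castSucc i.succ with hσ
  have hY := hX.submatrix σ.injective
  have hne : ∀ m, m ≠ i.val + 1 → leadingMinor (X.submatrix σ σ) m = leadingMinor X m := by
    intro m hm
    refine (leadingMinor_eq_det_submatrix X m
      (fun j : {j : Fin (n + 1) // j.val < m} => σ j)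
      (σ.injective.comp Subtype.val_injective) fun j => ?_).symm
    have hinv : ∀ j : Fin (n + 1), j.val < m → (σ j).val < m := by
      intro j hj
      rw [hσ, Equiv.swap_apply_def]
      split_ifs with h1 h2
      · subst h1; simp at hj ⊢; omega
      · subst h2; simp at hj ⊢; omega
      · exact hj
    refine ⟨fun hj => ⟨⟨σ j, hinv j hj⟩, by simp [hσ]⟩, ?_⟩
    rintro ⟨⟨k, hk⟩, rfl⟩
    exact hinv k hk
  set g : {j : Fin (n + 1) // j.val < i.val} → Fin (n + 1) := Subtype.val
  have hg : ∀ k, (g k).val < i.val := fun k => k.2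
  have h0 : leadingMinor X i = (X.submatrix g g).det := rfl
  have inj1 : ∀ a : Fin (n + 1), i.val ≤ a.val →
      Function.Injective (Sum.elim g fun _ : Unit => a) := by
    intro a ha
    refine Subtype.val_injective.sumElim (fun _ _ _ => rfl) fun k _ h => ?_
    have := hg k
    rw [show g k = a from h] at this
    omega
  have h1 : leadingMinor X (i + 1) = (X.submatrix (Sum.elim g fun _ : Unit => i.castSucc)
      (Sum.elim g fun _ : Unit => i.castSucc)).det := by
    refine leadingMinor_eq_det_submatrix X _ _ (inj1 _ (by simp)) fun j => ?_
    constructor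
    · intro hj
      by_cases h : j.val < i.val
      · exact ⟨Sum.inl ⟨j, h⟩, rfl⟩
      · exact ⟨Sum.inr (), Fin.ext (by simp; omega)⟩
    · rintro ⟨k | k, rfl⟩
      · have := hg k; simp; omega
      · simp
  have hσg : ∀ k, σ (g k) = g k := fun k => by
    have := hg k
    exact Equiv.swap_apply_of_ne_of_ne (fun h => by rw [h] at this; simp at this)
      (fun h => by rw [h] at this; simp at this)
  have h1' : leadingMinor (X.submatrix σ σ) (i + 1) =
      (X.submatrix (Sum.elim g fun _ : Unit => i.succ) (Sum.elim g fun _ : Unit => i.succ)).det := by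
    rw [leadingMinor_eq_det_submatrix (X.submatrix σ σ) (i + 1)
      (Sum.elim g fun _ : Unit => i.castSucc) (inj1 _ (by simp)), Matrix.submatrix_submatrix]
    · congr 1
      have : (σ ∘ Sum.elim g fun _ : Unit => i.castSucc) = Sum.elim g fun _ : Unit => i.succ := by
        ext (k | k)
        · simp [hσg]
        · simp [hσ]
      rw [this]
    · intro j
      constructor
      · intro hj
        by_cases h : j.val < i.val
        · exact ⟨Sum.inl ⟨j, h⟩, rfl⟩
        · exact ⟨Sum.inr (), Fin.ext (by simp; omega)⟩
      · rintro ⟨k | k, rfl⟩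
        · have := hg k; simp; omega
        · simp
  have h2 : leadingMinor X (i + 2) = (X.submatrix (Sum.elim g ![i.castSucc, i.succ])
      (Sum.elim g ![i.castSucc, i.succ])).det := by
    refine leadingMinor_eq_det_submatrix X _ _ ?_ fun j => ?_
    · refine Subtype.val_injective.sumElim ?_ fun k l h => ?_
      · intro a b h
        fin_cases a <;> fin_cases b <;> simp_all [Fin.ext_iff]
      · have := hg k
        rw [show g k = _ from h] at this
        fin_cases l <;> simp at this
    · constructor
      · intro hj
        by_cases h : j.val < i.val
        · exact ⟨Sum.inl ⟨j, h⟩, rfl⟩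
        · by_cases h' : j.val = i.val
          · exact ⟨Sum.inr 0, Fin.ext (by simp; omega)⟩
          · exact ⟨Sum.inr 1, Fin.ext (by simp; omega)⟩
      · rintro ⟨k | k, rfl⟩
        · have := hg k; simp; omega
        · fin_cases k <;> simp
  obtain ⟨f, hf⟩ := exists_det_submatrix_mul_eq hX.isSymm g i.castSucc i.succ
    (h0 ▸ hX.leadingMinor_ne_zero _)
  rw [← h0, ← h1, ← h1', ← h2] at hf
  have hpair := hilbertSym_mul_hilbertSym_eq p (hX.leadingMinor_ne_zero _)
    (hX.leadingMinor_ne_zero _) (hY.leadingMinor_ne_zero _) (hX.leadingMinor_ne_zero _) hf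
  have hi := i.isLt
  rw [hasseMinkowski_eq_prod_range p hX, hasseMinkowski_eq_prod_range p hY, hne _ (by omega)]
  congr 1
  have m1 : i.val ∈ Finset.range (n + 1) := by simp
  have m2 : i.val + 1 ∈ (Finset.range (n + 1)).erase i.val := by simp
  rw [← Finset.mul_prod_erase _ _ m1, ← Finset.mul_prod_erase _ _ m2, ← mul_assoc,
    ← Finset.mul_prod_erase _ _ m1, ← Finset.mul_prod_erase _ _ m2, ← mul_assoc,
    hne _ (by omega), hne (i + 1 + 1) (by omega), ← hpair]
  congr 1
  refine Finset.prod_congr rfl fun r hr => ?_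
  simp only [Finset.mem_erase, Finset.mem_range] at hr
  rw [hne _ (by omega), hne _ (by omega)]

theorem hasseMinkowski_submatrix_perm {n : ℕ} (σ : Equiv.Perm (Fin n)) :
    ∀ {X : Matrix (Fin n) (Fin n) ℚ}, IsAnisotropicMatrix X →
      hasseMinkowski p (X.submatrix σ σ) = hasseMinkowski p X := by
  cases n with
  | zero => intro X _; rw [Subsingleton.elim (X.submatrix σ σ) X]
  | succ n =>
    have hmem : σ ∈ Submonoid.closure
        (Set.range fun i : Fin n => Equiv.swap i.castSucc i.succ) := by
      rw [Equiv.Perm.mclosure_swap_castSucc_succ]; trivial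
    induction hmem using Submonoid.closure_induction with
    | mem x hx =>
      obtain ⟨i, rfl⟩ := hx
      exact fun {X} hX => hasseMinkowski_submatrix_swap p hX i
    | one => intro X _; rfl
    | mul x y _ _ hx hy =>
      intro X hX
      have : X.submatrix (x * y) (x * y) = (X.submatrix x x).submatrix y y := rfl
      rw [this, hy (hX.submatrix x.injective), hx hX]

/-- Invertible matrices are products of diagonal matrices and transvections. The diagonal and upper
ones scale minors by squares; a lower transvection becomes upper after swapping two indices. -/
theorem hasseMinkowski_transpose_mul_mul {n : ℕ} (P : Matrix (Fin n) (Fin n) ℚ) (hP : P.det ≠ 0) :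
    ∀ {X : Matrix (Fin n) (Fin n) ℚ}, IsAnisotropicMatrix X →
      hasseMinkowski p (P.transpose * X * P) = hasseMinkowski p X := by
  refine Matrix.diagonal_transvection_induction_of_det_ne_zero
    (fun P => ∀ {X : Matrix (Fin n) (Fin n) ℚ}, IsAnisotropicMatrix X →
      hasseMinkowski p (P.transpose * X * P) = hasseMinkowski p X) P hP ?_ ?_ ?_
  · intro D hD X hX
    exact hasseMinkowski_transpose_mul_mul_of_upper p hX
      (fun i j hij => Matrix.diagonal_apply_ne _ hij.ne') hD
  · rintro ⟨i, j, hij, c⟩ X hX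
    have hdet : ∀ {i j : Fin n}, i ≠ j → (Matrix.transvection i j c).det ≠ 0 := fun hij => by
      rw [Matrix.det_transvection_of_ne _ _ hij]; exact one_ne_zero
    have hup : ∀ {X : Matrix (Fin n) (Fin n) ℚ} {i j : Fin n}, IsAnisotropicMatrix X → i < j →
        hasseMinkowski p ((Matrix.transvection i j c).transpose * X * Matrix.transvection i j c) =
          hasseMinkowski p X := fun {X i j} hX h =>
      hasseMinkowski_transpose_mul_mul_of_upper p hX (fun a b hab => by
        rw [Matrix.transvection, Matrix.add_apply, Matrix.one_apply_ne hab.ne',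
          Matrix.single_apply_of_ne, add_zero]
        rintro ⟨rfl, rfl⟩
        exact absurd h hab.asymm) (hdet h.ne)
    change hasseMinkowski p ((Matrix.transvection i j c).transpose * X * Matrix.transvection i j c) =
          hasseMinkowski p X
    rcases lt_or_gt_of_ne hij with h | h
    · exact hup hX h
    · set σ := Equiv.swap i j with hσ
      have hA := hX.transpose_mul_mul (Matrix.transvection i j c) fun x hx => by_contra fun h0 =>
        hdet hij (Matrix.exists_mulVec_eq_zero_iff.mp ⟨x, h0, hx⟩)
      have hT : (Matrix.transvection i j c).submatrix σ σ = Matrix.transvection j i c := by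
        ext a b
        simp only [Matrix.transvection, Matrix.submatrix_apply, Matrix.add_apply, Matrix.one_apply,
          Matrix.single_apply, σ.injective.eq_iff]
        congr 2
        simp only [hσ, eq_comm (a := i), eq_comm (a := j), Equiv.swap_apply_eq_iff,
          Equiv.swap_apply_left, Equiv.swap_apply_right]
      rw [← hasseMinkowski_submatrix_perm p σ hA, ← Matrix.submatrix_mul_equiv _ _ σ σ σ,
        ← Matrix.submatrix_mul_equiv _ _ σ σ σ, ← Matrix.transpose_submatrix, hT,
        hup (hX.submatrix σ.injective) h, hasseMinkowski_submatrix_perm p σ hX]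
  · intro A B hA hB ihA ihB X hX
    have hAX := hX.transpose_mul_mul A fun x hx => by_contra fun h0 =>
      hA (Matrix.exists_mulVec_eq_zero_iff.mp ⟨x, h0, hx⟩)
    rw [← ihA hX, ← ihB hAX, Matrix.transpose_mul]
    simp only [Matrix.mul_assoc]

end Invariance

/-- Congruence of rational matrices, possibly indexed by different types. -/
def MatrixCongruent {ι κ : Type*} [Fintype ι] [Fintype κ] [DecidableEq ι] [DecidableEq κ]
    (X : Matrix ι ι ℚ) (Y : Matrix κ κ ℚ) : Prop :=
  ∃ (P : Matrix ι κ ℚ) (Q : Matrix κ ι ℚ), P * Q = 1 ∧ Q * P = 1 ∧ P.transpose * X * P = Y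

namespace MatrixCongruent

variable {ι κ τ : Type*} [Fintype ι] [Fintype κ] [Fintype τ] [DecidableEq ι] [DecidableEq κ]
  [DecidableEq τ] {X : Matrix ι ι ℚ} {Y : Matrix κ κ ℚ} {Z : Matrix τ τ ℚ}

theorem trans (h : MatrixCongruent X Y) (h' : MatrixCongruent Y Z) : MatrixCongruent X Z := by
  obtain ⟨P, Q, h1, h2, rfl⟩ := h
  obtain ⟨P', Q', h1', h2', rfl⟩ := h'
  refine ⟨P * P', Q' * Q, ?_, ?_, ?_⟩
  · rw [Matrix.mul_assoc, ← Matrix.mul_assoc P', h1', Matrix.one_mul, h1]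
  · rw [Matrix.mul_assoc, ← Matrix.mul_assoc Q, h2, Matrix.one_mul, h2']
  · simp only [Matrix.transpose_mul, Matrix.mul_assoc]

theorem symm (h : MatrixCongruent X Y) : MatrixCongruent Y X := by
  obtain ⟨P, Q, h1, h2, rfl⟩ := h
  refine ⟨Q, P, h2, h1, ?_⟩
  have h3 : Q.transpose * P.transpose = 1 := by
    rw [← Matrix.transpose_mul, h1, Matrix.transpose_one]
  rw [Matrix.mul_assoc, Matrix.mul_assoc, h1, Matrix.mul_one, ← Matrix.mul_assoc, h3,
    Matrix.one_mul]

theorem of_submatrix (e : κ ≃ ι) : MatrixCongruent X (X.submatrix e e) := by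
  refine ⟨(1 : Matrix ι ι ℚ).submatrix id e, (1 : Matrix ι ι ℚ).submatrix e id, ?_, ?_, ?_⟩
  · rw [Matrix.submatrix_mul_equiv _ _ _ e]; simp
  · rw [← Matrix.submatrix_mul _ _ _ _ _ Function.bijective_id]; simp
  · ext i j
    simp [Matrix.mul_apply, Matrix.one_apply]

theorem isAnisotropicMatrix (h : MatrixCongruent X Y) (hX : IsAnisotropicMatrix X) :
    IsAnisotropicMatrix Y := by
  obtain ⟨P, Q, -, h2, rfl⟩ := h
  refine hX.transpose_mul_mul P fun x hx => ?_
  rw [← Matrix.one_mulVec x, ← h2, ← Matrix.mulVec_mulVec, hx, Matrix.mulVec_zero]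

theorem hasseMinkowski_eq (p : ℕ) [Fact p.Prime] {n m : ℕ} (hnm : n = m)
    {X : Matrix (Fin n) (Fin n) ℚ} {Y : Matrix (Fin m) (Fin m) ℚ}
    (h : MatrixCongruent X Y) (hX : IsAnisotropicMatrix X) :
    hasseMinkowski p Y = hasseMinkowski p X := by
  subst hnm
  obtain ⟨P, Q, h1, -, rfl⟩ := h
  exact hasseMinkowski_transpose_mul_mul p P
    (fun h0 => by simpa [h0] using congrArg Matrix.det h1) hX

end MatrixCongruent

/-! ### Integral forms of determinant prime to `p` -/

theorem leadingMinor_map_intCast {n : ℕ} (U : Matrix (Fin n) (Fin n) ℤ) (i : ℕ) :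
    leadingMinor (U.map fun z : ℤ => (z : ℚ)) i =
      (((U.toSquareBlockProp fun j => j.val < i).det : ℤ) : ℚ) :=
  (Int.cast_det (R := ℚ) _).symm

theorem map_intCast_mul {ι κ τ R : Type*} [Fintype κ] [CommRing R] (A : Matrix ι κ ℤ)
    (B : Matrix κ τ ℤ) : ((A * B).map fun z : ℤ => (z : R)) =
      (A.map fun z : ℤ => (z : R)) * B.map fun z : ℤ => (z : R) := by
  ext i j
  simp [Matrix.mul_apply]

/-- For odd `p` the reduction of `U` has an orthogonal basis over `𝔽_p`; lifting its coordinates to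
integers gives `P`. This `P` is invertible modulo `p` but need not be unimodular, which suffices
because only square classes matter. -/
theorem exists_not_dvd_leadingMinor (p : ℕ) [Fact p.Prime] (hp2 : p ≠ 2) {m : ℕ}
    (U : Matrix (Fin m) (Fin m) ℤ) (hU : U.IsSymm) (hd : ¬ (p : ℤ) ∣ U.det) :
    ∃ P : Matrix (Fin m) (Fin m) ℤ, ¬ (p : ℤ) ∣ P.det ∧
      ∀ i, ¬ (p : ℤ) ∣ ((P.transpose * U * P).toSquareBlockProp fun j => j.val < i).det := by
  have h2 : (2 : ZMod p) ≠ 0 := by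
    intro h
    have : ((2 : ℕ) : ZMod p) = 0 := by exact_mod_cast h
    rw [ZMod.natCast_eq_zero_iff] at this
    exact hp2 ((Nat.prime_dvd_prime_iff_eq Fact.out Nat.prime_two).mp this)
  have := invertibleOfNonzero h2
  set V : Matrix (Fin m) (Fin m) (ZMod p) := U.map fun z : ℤ => (z : ZMod p) with hV
  have hcast : ∀ {ι : Type} [Fintype ι] [DecidableEq ι] (A : Matrix ι ι ℤ), ((A.det : ℤ) : ZMod p) =
      (A.map fun z : ℤ => (z : ZMod p)).det := fun A => Int.cast_det A
  have hVd : V.det ≠ 0 := by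
    rwa [hV, ← hcast, Ne, ZMod.intCast_zmod_eq_zero_iff_dvd]
  have hVs : V.IsSymm := hU.map _
  obtain ⟨v, hv⟩ := LinearMap.BilinForm.exists_orthogonal_basis (B := V.toBilin')
    ⟨fun x y => (Matrix.isSymm_toBilin'_iff_isSymm.mpr hVs).eq x y⟩
  let w := v.reindex (finCongr (Module.finrank_fin_fun (ZMod p)))
  have hw : ∀ i j, i ≠ j → V.toBilin' (w i) (w j) = 0 := by
    intro i j hij
    simp only [w, Module.Basis.reindex_apply]
    exact hv (fun h => hij (by simpa using h))
  set R : Matrix (Fin m) (Fin m) (ZMod p) := Matrix.of fun i j => w j i with hR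
  have hRd : R.det ≠ 0 := by
    have : R = (Pi.basisFun (ZMod p) (Fin m)).toMatrix w := by
      ext i j; simp [hR, Module.Basis.toMatrix_apply]
    rw [this]
    have h1 := congrArg Matrix.det ((Pi.basisFun (ZMod p) (Fin m)).toMatrix_mul_toMatrix_flip w)
    intro h0
    rw [Matrix.det_mul, h0] at h1
    simp at h1
  have hG : ∀ i j, (R.transpose * V * R) i j = V.toBilin' (w i) (w j) := by
    intro i j
    rw [Matrix.toBilin'_apply', Matrix.mul_assoc]
    simp [Matrix.mul_apply, dotProduct, Matrix.mulVec, hR]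
  have hGd : (R.transpose * V * R).det ≠ 0 := by
    rw [Matrix.det_mul, Matrix.det_mul, Matrix.det_transpose]
    exact mul_ne_zero (mul_ne_zero hRd hVd) hRd
  have hGe : R.transpose * V * R = Matrix.diagonal fun i => V.toBilin' (w i) (w i) := by
    ext i j
    rw [hG]
    by_cases hij : i = j
    · subst hij; simp
    · rw [Matrix.diagonal_apply_ne _ hij, hw i j hij]
  have hii : ∀ i, V.toBilin' (w i) (w i) ≠ 0 := by
    rw [hGe, Matrix.det_diagonal, Finset.prod_ne_zero_iff] at hGd
    exact fun i => hGd i (Finset.mem_univ i)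
  set P : Matrix (Fin m) (Fin m) ℤ := R.map fun z => (z.val : ℤ) with hP
  have hPR : P.map (fun z : ℤ => (z : ZMod p)) = R := by
    ext i j; simp [hP]
  refine ⟨P, ?_, fun i => ?_⟩
  · rwa [← ZMod.intCast_zmod_eq_zero_iff_dvd _ p, hcast, hPR]
  · rw [← ZMod.intCast_zmod_eq_zero_iff_dvd _ p, hcast]
    have e : ((P.transpose * U * P).toSquareBlockProp fun j => j.val < i).map
        (fun z : ℤ => (z : ZMod p)) =
        Matrix.diagonal fun j : {j : Fin m // j.val < i} => V.toBilin' (w j) (w j) := by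
      have h3 : (P.transpose * U * P).map (fun z : ℤ => (z : ZMod p)) = R.transpose * V * R := by
        rw [map_intCast_mul, map_intCast_mul, Matrix.transpose_map, hPR]
      ext a b
      have h4 := congrFun (congrFun h3 a.1) b.1
      rw [hGe] at h4
      simp only [Matrix.map_apply, Matrix.toSquareBlockProp_def, Matrix.of_apply] at h4 ⊢
      rw [h4]
      simp [Matrix.diagonal_apply, Subtype.ext_iff]
    rw [e, Matrix.det_diagonal]
    exact Finset.prod_ne_zero_iff.mpr fun j _ => hii j

/-! ### The form `c I + e J` -/

theorem det_scalar_add_const {κ : Type*} [Fintype κ] [DecidableEq κ] {c : ℚ} (hc : c ≠ 0) (e : ℚ) :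
    (Matrix.of fun i j : κ => (if i = j then c else 0) + e).det =
      c ^ Fintype.card κ * (1 + Fintype.card κ * e / c) := by
  have h : (Matrix.of fun i j : κ => (if i = j then c else 0) + e) =
      c • (1 + Matrix.replicateCol Unit (fun _ : κ => e / c) *
        Matrix.replicateRow Unit (fun _ : κ => (1 : ℚ))) := by
    ext i j
    simp [Matrix.mul_apply, Matrix.one_apply, mul_add, mul_div_cancel₀ _ hc]
  rw [h, Matrix.det_smul, Matrix.det_one_add_replicateCol_mul_replicateRow]
  simp [dotProduct, mul_div_assoc]

theorem leadingMinor_scalar_add_const {t : ℕ} {c : ℚ} (hc : c ≠ 0) (e : ℚ) {j : ℕ} (hj : j ≤ t) :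
    leadingMinor (Matrix.of fun i j : Fin t => (if i = j then c else 0) + e) j =
      c ^ j * (1 + j * e / c) := by
  rw [leadingMinor_eq_det_submatrix _ j (Fin.castLE hj) (Fin.castLE_injective hj)]
  · have := det_scalar_add_const (κ := Fin j) hc e
    rw [Fintype.card_fin] at this
    rw [← this]
    congr 1
    ext a b
    simp
  · intro k
    exact ⟨fun h => ⟨⟨k, h⟩, rfl⟩, by rintro ⟨l, rfl⟩; exact l.2⟩

section ScalarAddConst

variable (p : ℕ) [Fact p.Prime]

theorem hilbertSym_mul_self_left {x y : ℚ} (hx : x ≠ 0) (hy : y ≠ 0) :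
    hilbertSym p x (x * y) = hilbertSym p x (-y) := by
  rw [← neg_mul_neg, hilbertSym_mul_right p (neg_ne_zero.mpr hx) (neg_ne_zero.mpr hy) hx,
    hilbertSym_self_neg p hx, one_mul]

/-- Separates a factor `d` common to all minors. Along a chain of minors the symbols `(d, x)` then
occur twice and cancel. -/
theorem hilbertSym_mul_neg_mul {d x y : ℚ} (hd : d ≠ 0) (hx : x ≠ 0) (hy : y ≠ 0) :
    hilbertSym p (d * x) (-(d * y)) =
      hilbertSym p d x * hilbertSym p d y * hilbertSym p x (-y) := by
  rw [hilbertSym_mul_left p hd hx (neg_ne_zero.mpr (mul_ne_zero hd hy)), ← mul_neg,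
    hilbertSym_mul_self_left p hd (neg_ne_zero.mpr hy), neg_neg,
    hilbertSym_mul_right p hd (neg_ne_zero.mpr hy) hx, hilbertSym_comm p x d]
  ring

theorem hilbertSym_mul_sq_mul_sq {d x y s u : ℚ} (hd : d ≠ 0) (hx : x ≠ 0) (hy : y ≠ 0)
    (hs : s ≠ 0) (hu : u ≠ 0) : hilbertSym p (d * (x * s ^ 2)) (-(d * (y * u ^ 2))) =
      hilbertSym p d x * hilbertSym p d y * hilbertSym p x (-y) := by
  have h1 := mul_ne_zero hd hx
  have h2 := neg_ne_zero.mpr (mul_ne_zero hd hy)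
  rw [← mul_assoc, ← mul_assoc, ← neg_mul,
    hilbertSym_mul_sq_left p h1 (mul_ne_zero h2 (pow_ne_zero _ hu)) hs,
    hilbertSym_mul_sq_right p h2 h1 hu, hilbertSym_mul_neg_mul p hd hx hy]

theorem hilbertSym_mul_neg_neg {x y z : ℚ} (hx : x ≠ 0) (hy : y ≠ 0) (hz : z ≠ 0) :
    hilbertSym p x (-y) * hilbertSym p x (-z) = hilbertSym p x (y * z) := by
  rw [← hilbertSym_mul_right p (neg_ne_zero.mpr hy) (neg_ne_zero.mpr hz) hx, neg_mul_neg]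

/-- Since `w w' + e w' = w' ^ 2`, the symbol `(w w', e w')` is trivial. This is the telescoping
relation for the numbers `c + j e`. -/
theorem hilbertSym_of_add_eq {e w w' : ℚ} (he : e ≠ 0) (hw : w ≠ 0) (hw' : w' ≠ 0)
    (h : w + e = w') : hilbertSym p w (e * w') = hilbertSym p w' (-e) := by
  have h1 : hilbertSym p (w * w') (e * w') = 1 :=
    hilbertSym_eq_one_of_add_eq_sq p (f := w') (mul_ne_zero hw hw') (mul_ne_zero he hw')
      (by rw [← h]; ring)
  rw [hilbertSym_mul_left p hw hw' (mul_ne_zero he hw'), mul_comm e w',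
    hilbertSym_mul_self_left p hw' he] at h1
  have h2 := hilbertSym_sq p hw' (neg_ne_zero.mpr he)
  calc _ = hilbertSym p w (w' * e) * hilbertSym p w' (-e) ^ 2 := by rw [h2, mul_one, mul_comm e]
    _ = _ := by rw [sq, ← mul_assoc, h1, one_mul]

/-- The leading principal minors of `c I + e J`. -/
def scalarAddConstMinor (c e : ℚ) (j : ℕ) : ℚ := c ^ j * (1 + j * e / c)

variable {c e d : ℚ}

/-- Modulo squares the minor of order `j` is `c (c + j e)` for even `j` and `c + j e` for odd `j`,
so the product below is treated two factors at a time. -/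
theorem scalarAddConstMinor_two_mul (hc : c ≠ 0) (r : ℕ) :
    scalarAddConstMinor c e (2 * r) = c * (c + (2 * r : ℕ) * e) * (c ^ r / c) ^ 2 := by
  rw [scalarAddConstMinor, pow_mul']
  field_simp

theorem scalarAddConstMinor_two_mul_add_one (hc : c ≠ 0) (r : ℕ) :
    scalarAddConstMinor c e (2 * r + 1) = (c + (2 * r + 1 : ℕ) * e) * (c ^ r) ^ 2 := by
  rw [scalarAddConstMinor, pow_succ, pow_mul']
  field_simp

/-- Induction on `r`: two further factors move the end point of the telescoping product from `c + (2
r + 1) e` to `c + (2 r + 3) e` and leave one extra `(c, -1)`. -/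
theorem prod_hilbertSym_scalarAddConstMinor (hc : c ≠ 0) (he : e ≠ 0) (hd : d ≠ 0)
    (r : ℕ) (hw : ∀ j : ℕ, j ≤ 2 * r + 1 → c + j * e ≠ 0) :
    ∏ j ∈ Finset.range (2 * r + 1), hilbertSym p (d * scalarAddConstMinor c e j)
        (-(d * scalarAddConstMinor c e (j + 1))) =
      hilbertSym p d (c + (2 * r + 1 : ℕ) * e) * hilbertSym p c (-1) ^ r * hilbertSym p c e *
        hilbertSym p (c + (2 * r + 1 : ℕ) * e) (-(c * e)) := by
  have hev : ∀ r : ℕ, c + (2 * r : ℕ) * e ≠ 0 → c + (2 * r + 1 : ℕ) * e ≠ 0 →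
      hilbertSym p (d * scalarAddConstMinor c e (2 * r))
        (-(d * scalarAddConstMinor c e (2 * r + 1))) =
      hilbertSym p d (c * (c + (2 * r : ℕ) * e)) * hilbertSym p d (c + (2 * r + 1 : ℕ) * e) *
        hilbertSym p (c * (c + (2 * r : ℕ) * e)) (-(c + (2 * r + 1 : ℕ) * e)) := by
    intro r h1 h2
    have h3 := mul_ne_zero hc h1
    have h4 : c ^ r / c ≠ 0 := div_ne_zero (pow_ne_zero _ hc) hc
    rw [scalarAddConstMinor_two_mul hc, scalarAddConstMinor_two_mul_add_one hc,
      hilbertSym_mul_sq_mul_sq p hd h3 h2 h4 (pow_ne_zero _ hc)]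
  have hodd : ∀ r : ℕ, c + (2 * r + 1 : ℕ) * e ≠ 0 → c + (2 * (r + 1) : ℕ) * e ≠ 0 →
      hilbertSym p (d * scalarAddConstMinor c e (2 * r + 1))
        (-(d * scalarAddConstMinor c e (2 * (r + 1)))) =
      hilbertSym p d (c + (2 * r + 1 : ℕ) * e) * hilbertSym p d (c * (c + (2 * (r + 1) : ℕ) * e)) *
        hilbertSym p (c + (2 * r + 1 : ℕ) * e) (-(c * (c + (2 * (r + 1) : ℕ) * e))) := by
    intro r h1 h2
    have h3 := mul_ne_zero hc h2
    have h4 : c ^ (r + 1) / c ≠ 0 := div_ne_zero (pow_ne_zero _ hc) hc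
    rw [scalarAddConstMinor_two_mul hc, scalarAddConstMinor_two_mul_add_one hc,
      hilbertSym_mul_sq_mul_sq p hd h1 h3 (pow_ne_zero _ hc) h4]
  induction r with
  | zero =>
    have h0 := hw 1 le_rfl
    rw [Nat.cast_one, one_mul] at h0
    have h3 := hev 0 (by simpa using hc) (by simpa using h0)
    simp only [Nat.mul_zero, zero_add, Nat.cast_zero, zero_mul, add_zero, Nat.cast_one, one_mul] at h3
    simp only [Nat.mul_zero, zero_add, Finset.prod_range_one, h3, pow_zero, mul_one, Nat.cast_one,
      one_mul]
    have h5 : hilbertSym p d (c * c) = 1 := by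
      rw [← sq, hilbertSym_comm, hilbertSym_sq_left p hc hd]
    have h6 : hilbertSym p (c * c) (-(c + e)) = 1 := by
      rw [← sq, hilbertSym_sq_left p hc (neg_ne_zero.mpr h0)]
    have h7 : hilbertSym p c e * hilbertSym p (c + e) (-(c * e)) = 1 := by
      rw [neg_mul_eq_mul_neg, hilbertSym_mul_right p hc (neg_ne_zero.mpr he) h0,
        ← hilbertSym_of_add_eq p he hc h0 rfl, hilbertSym_mul_right p he h0 hc,
        hilbertSym_comm p (c + e) c]
      have := hilbertSym_sq p hc he
      have := hilbertSym_sq p hc h0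
      linear_combination (hilbertSym p c (c + e)) ^ 2 * hilbertSym_sq p hc he + this
    rw [h5, h6, mul_assoc _ (hilbertSym p c e), h7]
    ring
  | succ r ih =>
    have h1 := hw (2 * r + 1) (by omega)
    have h2 := hw (2 * (r + 1)) (by omega)
    have h3 := hw (2 * (r + 1) + 1) (by omega)
    rw [show 2 * (r + 1) + 1 = (2 * r + 1) + 1 + 1 by ring, Finset.prod_range_succ,
      Finset.prod_range_succ, ih fun j hj => hw j (by omega),
      show (2 * r + 1) + 1 = 2 * (r + 1) by ring, hodd r h1 h2, hev (r + 1) h2 h3]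
    have e1 : c + (2 * r + 1 : ℕ) * e + e = c + (2 * (r + 1) : ℕ) * e := by push_cast; ring
    have e2 : c + (2 * (r + 1) : ℕ) * e + e = c + (2 * (r + 1) + 1 : ℕ) * e := by push_cast; ring
    generalize c + (2 * r + 1 : ℕ) * e = x at *
    generalize c + (2 * (r + 1) : ℕ) * e = y at *
    generalize c + (2 * (r + 1) + 1 : ℕ) * e = z at *
    have hcy := mul_ne_zero hc h2
    have s1 := hilbertSym_sq p hd h1
    have s2 := hilbertSym_sq p hd hcy
    have k1 : hilbertSym p x (-(c * e)) * hilbertSym p x (-(c * y)) = hilbertSym p y (-e) := by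
      rw [hilbertSym_mul_neg_neg p h1 (mul_ne_zero hc he) hcy,
        show c * e * (c * y) = e * y * c ^ 2 by ring,
        hilbertSym_mul_sq_right p (mul_ne_zero he h2) h1 hc, hilbertSym_of_add_eq p he h1 h2 e1]
    have k2 : hilbertSym p c e * hilbertSym p y (-e) * hilbertSym p (c * y) (-z) =
        hilbertSym p c (-1) * hilbertSym p c e * hilbertSym p z (-(c * e)) := by
      have a1 := hilbertSym_mul_left p hc h2 (neg_ne_zero.mpr h3)
      have a2 := hilbertSym_mul_neg_neg p h2 he h3
      have a3 := hilbertSym_of_add_eq p he h2 h3 e2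
      have a4 : hilbertSym p z (-(c * e)) = hilbertSym p c z * hilbertSym p z (-e) := by
        rw [neg_mul_eq_mul_neg, hilbertSym_mul_right p hc (neg_ne_zero.mpr he) h3,
          hilbertSym_comm p z c]
      have a5 : hilbertSym p c (-z) = hilbertSym p c (-1) * hilbertSym p c z := by
        rw [← neg_one_mul, hilbertSym_mul_right p (by norm_num) h3 hc]
      rw [a1, a4, a5, ← a3, ← a2]
      ring
    rw [pow_succ]
    linear_combination (hilbertSym p d z * hilbertSym p c (-1) ^ r * hilbertSym p c e *
        hilbertSym p (c * y) (-z) * hilbertSym p x (-(c * e)) * hilbertSym p x (-(c * y))) *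
        (hilbertSym p d (c * y) ^ 2 * s1 + s2) +
      (hilbertSym p d z * hilbertSym p c (-1) ^ r * hilbertSym p c e *
        hilbertSym p (c * y) (-z)) * k1 +
      (hilbertSym p d z * hilbertSym p c (-1) ^ r) * k2

end ScalarAddConst

/-! ### Orthogonal sums with an integral form of determinant prime to `p` -/

/-- The orthogonal sum of two forms, with rows numbered consecutively. -/
def directSumMatrix {m t : ℕ} (D : Matrix (Fin m) (Fin m) ℚ) (Y : Matrix (Fin t) (Fin t) ℚ) :
    Matrix (Fin (m + t)) (Fin (m + t)) ℚ :=
  (Matrix.fromBlocks D 0 0 Y).submatrix finSumFinEquiv.symm finSumFinEquiv.symm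

theorem leadingMinor_directSumMatrix_left {m t : ℕ} (D : Matrix (Fin m) (Fin m) ℚ)
    (Y : Matrix (Fin t) (Fin t) ℚ) {i : ℕ} (hi : i ≤ m) :
    leadingMinor (directSumMatrix D Y) i = leadingMinor D i := by
  rw [leadingMinor_eq_det_submatrix (directSumMatrix D Y) i
    (fun k : {k : Fin m // k.val < i} => Fin.castAdd t k)
    ((Fin.castAdd_injective m t).comp Subtype.val_injective)]
  · rw [leadingMinor]
    congr 1
    ext a b
    simp [directSumMatrix, Matrix.toSquareBlockProp_def]
  · intro j
    exact ⟨fun h => ⟨⟨⟨j, by omega⟩, h⟩, rfl⟩, by rintro ⟨k, rfl⟩; exact k.2⟩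

theorem leadingMinor_directSumMatrix_right {m t : ℕ} (D : Matrix (Fin m) (Fin m) ℚ)
    (Y : Matrix (Fin t) (Fin t) ℚ) (i : ℕ) :
    leadingMinor (directSumMatrix D Y) (m + i) = D.det * leadingMinor Y i := by
  rw [leadingMinor_eq_det_submatrix (directSumMatrix D Y) (m + i)
    (Sum.elim (Fin.castAdd t) fun k : {k : Fin t // k.val < i} => Fin.natAdd m k)]
  · rw [leadingMinor, ← Matrix.det_fromBlocks_zero₂₁ D 0 _]
    congr 1
    ext (a | a) (b | b) <;> simp [directSumMatrix, Matrix.toSquareBlockProp_def]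
  · refine (Fin.castAdd_injective m t).sumElim
      ((Fin.natAdd_injective t m).comp Subtype.val_injective) fun a b h => ?_
    have := congrArg Fin.val h
    simp at this
    omega
  · intro j
    constructor
    · intro h
      by_cases hj : j.val < m
      · exact ⟨Sum.inl ⟨j, hj⟩, rfl⟩
      · exact ⟨Sum.inr ⟨⟨j - m, by omega⟩, by simp; omega⟩, Fin.ext (by simp; omega)⟩
    · rintro ⟨k | k, rfl⟩
      · simp; omega
      · simpa using k.2

/-- After an integral change of basis all leading minors of the first summand are prime to `p`, so
its factors are symbols of two units, hence 1. The remaining minors are those of `Y` scaled by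
`U.det` and a square. -/
theorem hasseMinkowski_directSumMatrix (p : ℕ) [Fact p.Prime] (hp2 : p ≠ 2) {m t : ℕ}
    (U : Matrix (Fin m) (Fin m) ℤ) (hU : U.IsSymm) (hd : ¬ (p : ℤ) ∣ U.det)
    (Y : Matrix (Fin t) (Fin t) ℚ)
    (hX : IsAnisotropicMatrix (directSumMatrix (U.map fun z : ℤ => (z : ℚ)) Y)) :
    hasseMinkowski p (directSumMatrix (U.map fun z : ℤ => (z : ℚ)) Y) =
      hilbertSym p (-1) (-((U.det : ℚ) * leadingMinor Y t)) *
        ∏ j ∈ Finset.range t, hilbertSym p ((U.det : ℚ) * leadingMinor Y j)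
          (-((U.det : ℚ) * leadingMinor Y (j + 1))) := by
  obtain ⟨P, hPd, hP⟩ := exists_not_dvd_leadingMinor p hp2 U hU hd
  have hP0 : ((P.det : ℤ) : ℚ) ≠ 0 := by
    norm_cast
    rintro h
    simp [h] at hPd
  set U' := P.transpose * U * P with hU'
  set R : Matrix (Fin m) (Fin m) ℚ := P.map fun z : ℤ => (z : ℚ) with hR
  have hRd : R.det = (P.det : ℚ) := (Int.cast_det (R := ℚ) P).symm
  have hRu : IsUnit R.det := isUnit_iff_ne_zero.mpr (hRd ▸ hP0)
  have hUR : U'.map (fun z : ℤ => (z : ℚ)) =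
      R.transpose * (U.map fun z : ℤ => (z : ℚ)) * R := by
    rw [hU', map_intCast_mul, map_intCast_mul, Matrix.transpose_map]
  have hcong : MatrixCongruent (directSumMatrix (U.map fun z : ℤ => (z : ℚ)) Y)
      (directSumMatrix (U'.map fun z : ℤ => (z : ℚ)) Y) := by
    have h1 := MatrixCongruent.of_submatrix (finSumFinEquiv (m := m) (n := t))
      (X := directSumMatrix (U.map fun z : ℤ => (z : ℚ)) Y)
    rw [directSumMatrix, Matrix.submatrix_submatrix, Equiv.symm_comp_self,
      Matrix.submatrix_id_id] at h1
    refine h1.trans (MatrixCongruent.trans ?_ (MatrixCongruent.of_submatrix finSumFinEquiv.symm))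
    refine ⟨Matrix.fromBlocks R 0 0 1, Matrix.fromBlocks R⁻¹ 0 0 1, ?_, ?_, ?_⟩
    · simp [Matrix.fromBlocks_multiply, Matrix.mul_nonsing_inv _ hRu, Matrix.fromBlocks_one]
    · simp [Matrix.fromBlocks_multiply, Matrix.nonsing_inv_mul _ hRu, Matrix.fromBlocks_one]
    · simp [Matrix.fromBlocks_multiply, Matrix.fromBlocks_transpose, hUR]
  have hX' := hcong.isAnisotropicMatrix hX
  have hdet : (U'.map fun z : ℤ => (z : ℚ)).det = (U.det : ℚ) * (P.det : ℚ) ^ 2 := by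
    rw [hUR, Matrix.det_mul, Matrix.det_mul, Matrix.det_transpose, hRd,
      show (U.map fun z : ℤ => (z : ℚ)).det = (U.det : ℚ) from (Int.cast_det U).symm]
    ring
  have hY : ∀ i, (U.det : ℚ) * leadingMinor Y i ≠ 0 := by
    intro i
    have := hX.leadingMinor_ne_zero (m + i)
    rwa [leadingMinor_directSumMatrix_right, ← Int.cast_det] at this
  have hr : ∀ i, leadingMinor (directSumMatrix (U'.map fun z : ℤ => (z : ℚ)) Y) (m + i) =
      (U.det : ℚ) * leadingMinor Y i * (P.det : ℚ) ^ 2 := by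
    intro i
    rw [leadingMinor_directSumMatrix_right, hdet]
    ring
  have hneg : ∀ i, -((U.det : ℚ) * leadingMinor Y i * (P.det : ℚ) ^ 2) =
      -((U.det : ℚ) * leadingMinor Y i) * (P.det : ℚ) ^ 2 := fun i => by ring
  rw [← hcong.hasseMinkowski_eq p rfl hX, hasseMinkowski_eq_prod_range p hX',
    Finset.prod_range_add, Finset.prod_eq_one, one_mul, hr, hneg,
    hilbertSym_mul_sq_right p (neg_ne_zero.mpr (hY _)) (by norm_num) hP0]
  · congr 1
    refine Finset.prod_congr rfl fun j _ => ?_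
    rw [hr, add_assoc, hr, hneg, hilbertSym_mul_sq_left p (hY _) _ hP0,
      hilbertSym_mul_sq_right p (neg_ne_zero.mpr (hY _)) (hY _) hP0]
    exact mul_ne_zero (neg_ne_zero.mpr (hY _)) (pow_ne_zero _ hP0)
  · intro i hi
    rw [Finset.mem_range] at hi
    rw [leadingMinor_directSumMatrix_left _ _ hi.le, leadingMinor_directSumMatrix_left _ _ hi,
      leadingMinor_map_intCast, leadingMinor_map_intCast, ← Int.cast_neg]
    exact hilbertSym_eq_one_of_not_dvd p (hP i) (by rw [Int.dvd_neg]; exact hP (i + 1))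

/-- The Hasse-Minkowski invariant of the orthogonal sum of an integral form whose determinant is
prime to `p` and in the square class of `n`, and `c I + e J`. -/
theorem hasseMinkowski_directSumMatrix_scalar_add_const (p : ℕ) [Fact p.Prime] (hp2 : p ≠ 2)
    {m r : ℕ} (U : Matrix (Fin m) (Fin m) ℤ) (hU : U.IsSymm) (hd : ¬ (p : ℤ) ∣ U.det)
    {n z : ℤ} (hn : ¬ (p : ℤ) ∣ n) (hz : (p : ℤ) ∣ U.det * n - z ^ 2)
    {a l e k u : ℚ} (ha : a ≠ 0) (hl : l ≠ 0) (hu : u ≠ 0) (he : e = l * u ^ 2)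
    (hk : k ≠ 0) (hw : n * a + (2 * r + 1 : ℕ) * e = n * k ^ 2)
    (hw0 : ∀ j : ℕ, j ≤ 2 * r + 1 → n * a + j * e ≠ 0)
    (hX : IsAnisotropicMatrix (directSumMatrix (U.map fun z : ℤ => (z : ℚ))
      (Matrix.of fun i j : Fin (2 * r + 1) => (if i = j then n * a else 0) + e))) :
    hasseMinkowski p (directSumMatrix (U.map fun z : ℤ => (z : ℚ))
      (Matrix.of fun i j : Fin (2 * r + 1) => (if i = j then n * a else 0) + e)) =
        hilbertSym p a ((-1) ^ r * n * l) := by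
  have hn0 : (n : ℚ) ≠ 0 := by
    norm_cast
    rintro rfl
    simp at hn
  have hd0 : (U.det : ℚ) ≠ 0 := by
    norm_cast
    rintro h
    simp [h] at hd
  have hc : (n : ℚ) * a ≠ 0 := mul_ne_zero hn0 ha
  have he0 : e ≠ 0 := by rw [he]; exact mul_ne_zero hl (pow_ne_zero _ hu)
  have hm1 : (-1 : ℚ) ≠ 0 := by norm_num
  have hdn : ∀ x : ℚ, x ≠ 0 → hilbertSym p (U.det : ℚ) x = hilbertSym p n x :=
    fun x hx => hilbertSym_congr_of_dvd p hx hd hn hz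
  have hnn : hilbertSym p n n = 1 := hilbertSym_eq_one_of_not_dvd p hn hn
  have hminor : ∀ j ≤ 2 * r + 1, leadingMinor
      (Matrix.of fun i j : Fin (2 * r + 1) => (if i = j then (n : ℚ) * a else 0) + e) j =
      scalarAddConstMinor ((n : ℚ) * a) e j := fun j hj => leadingMinor_scalar_add_const hc e hj
  rw [hasseMinkowski_directSumMatrix p hp2 U hU hd _ hX]
  have hprod : ∀ j ∈ Finset.range (2 * r + 1),
      hilbertSym p ((U.det : ℚ) * leadingMinor (Matrix.of fun i j : Fin (2 * r + 1) =>
          (if i = j then (n : ℚ) * a else 0) + e) j)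
        (-((U.det : ℚ) * leadingMinor (Matrix.of fun i j : Fin (2 * r + 1) =>
          (if i = j then (n : ℚ) * a else 0) + e) (j + 1))) =
      hilbertSym p ((U.det : ℚ) * scalarAddConstMinor ((n : ℚ) * a) e j)
        (-((U.det : ℚ) * scalarAddConstMinor ((n : ℚ) * a) e (j + 1))) := by
    intro j hj
    rw [Finset.mem_range] at hj
    rw [hminor _ hj.le, hminor _ hj]
  rw [Finset.prod_congr rfl hprod, prod_hilbertSym_scalarAddConstMinor p hc he0 hd0 r hw0,
    hminor _ le_rfl, scalarAddConstMinor_two_mul_add_one hc, hw]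
  have hc0 : ((n : ℚ) * a) ^ r ≠ 0 := pow_ne_zero _ hc
  -- By `hw` the last weight `c + t e`, with `c = n a` and `t = 2 r + 1`, lies in the square class
  -- of `n`. Each symbol left over is now reduced to symbols among `a`, `n`, `l` and -1, those of
  -- two units being trivial.
  have f1 : hilbertSym p (-1) (-((U.det : ℚ) * (n * k ^ 2 * ((n * a) ^ r) ^ 2))) = 1 := by
    rw [show -((U.det : ℚ) * (n * k ^ 2 * ((n * a) ^ r) ^ 2)) =
      ((-(U.det * n) : ℤ) : ℚ) * (k * (n * a) ^ r) ^ 2 by push_cast; ring,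
      hilbertSym_mul_sq_right p _ hm1 (mul_ne_zero hk hc0)]
    · have := hilbertSym_eq_one_of_not_dvd p (not_dvd_neg_one p)
        (b := -(U.det * n)) (by rw [Int.dvd_neg]; exact not_dvd_mul p hd hn)
      simpa using this
    · rw [Int.cast_neg, Int.cast_mul]
      exact neg_ne_zero.mpr (mul_ne_zero hd0 hn0)
  have hl0 := mul_ne_zero hc hl
  have f2 : hilbertSym p (U.det : ℚ) (n * k ^ 2) = 1 := by
    rw [hilbertSym_mul_sq_right p hn0 hd0 hk, hdn _ hn0, hnn]
  have f3 : hilbertSym p (n * a) (-1) = hilbertSym p a (-1) := by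
    have h1 := hilbertSym_eq_one_of_not_dvd p hn (not_dvd_neg_one p)
    rw [hilbertSym_mul_left p hn0 ha hm1]
    push_cast at h1
    rw [h1, one_mul]
  have f4 : hilbertSym p (n * a) e = hilbertSym p n l * hilbertSym p a l := by
    rw [he, hilbertSym_mul_sq_right p hl hc hu, hilbertSym_mul_left p hn0 ha hl]
  have f5 : hilbertSym p (n * k ^ 2) (-(n * a * e)) = hilbertSym p n a * hilbertSym p n l := by
    rw [he, show -((n : ℚ) * a * (l * u ^ 2)) = n * (-(a * l)) * u ^ 2 by ring,
      hilbertSym_mul_sq_left p hn0 _ hk, hilbertSym_mul_sq_right p _ hn0 hu,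
      hilbertSym_mul_self_left p hn0, neg_neg, hilbertSym_mul_right p ha hl hn0]
    all_goals simp [hn0, ha, hl, hu]
  have f6 : hilbertSym p a ((-1) ^ r * n * l) =
      hilbertSym p a (-1) ^ r * hilbertSym p a n * hilbertSym p a l := by
    have h1 : ∀ r : ℕ, hilbertSym p a ((-1) ^ r) = hilbertSym p a (-1) ^ r := by
      intro r
      induction r with
      | zero => rw [pow_zero, pow_zero, hilbertSym_comm, hilbertSym_one_left p ha]
      | succ r ih => rw [pow_succ, hilbertSym_mul_right p (pow_ne_zero _ hm1) hm1 ha, ih, ← pow_succ]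
    rw [hilbertSym_mul_right p (mul_ne_zero (pow_ne_zero _ hm1) hn0) hl ha,
      hilbertSym_mul_right p (pow_ne_zero _ hm1) hn0 ha, h1]
  have hs := hilbertSym_sq p hn0 hl
  rw [f1, f2, f3, f4, f5, f6, hilbertSym_comm p a n]
  linear_combination (hilbertSym p a (-1) ^ r * hilbertSym p a l * hilbertSym p n a) * hs

/-! ### The cyclic shift and the sum-zero lattice -/

section Cycle

/-- The permutation matrix of the cycle `(0, 1, …, m)`. -/
def cycleShift (m : ℕ) (R : Type*) [CommRing R] : Matrix (Fin (m + 1)) (Fin (m + 1)) R :=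
  Matrix.of fun i j => if i + 1 = j then 1 else 0

/-- The columns `e_y - e_m`, a basis of the vectors with coordinate sum zero. -/
def sumZeroBasis (m : ℕ) (R : Type*) [CommRing R] : Matrix (Fin (m + 1)) (Fin m) R :=
  Matrix.of fun x y => (if x = y.castSucc then 1 else 0) - if x = Fin.last m then 1 else 0

/-- The symmetric matrix `a I + S + Sᵀ`, where `S` is the cyclic shift. -/
def shiftMatrix (m : ℕ) {R : Type*} [CommRing R] (a : R) : Matrix (Fin (m + 1)) (Fin (m + 1)) R :=
  a • 1 + cycleShift m R + (cycleShift m R).transpose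

/-- The Gram matrix of the form `a I + S + Sᵀ` on the vectors with coordinate sum zero. -/
def sumZeroGram (m : ℕ) {R : Type*} [CommRing R] (a : R) : Matrix (Fin m) (Fin m) R :=
  (sumZeroBasis m R).transpose * shiftMatrix m a * sumZeroBasis m R

variable {m : ℕ} {R : Type*} [CommRing R]

theorem shiftMatrix_isSymm (a : R) : (shiftMatrix m a).IsSymm := by
  simp [Matrix.IsSymm, shiftMatrix, add_right_comm]

theorem sumZeroGram_isSymm (a : R) : (sumZeroGram m a).IsSymm := by
  rw [Matrix.IsSymm, sumZeroGram, Matrix.transpose_mul, Matrix.transpose_mul,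
    Matrix.transpose_transpose, (shiftMatrix_isSymm a).eq, Matrix.mul_assoc]

theorem cycleShift_mulVec (x : Fin (m + 1) → R) (i : Fin (m + 1)) :
    (cycleShift m R).mulVec x i = x (i + 1) := by
  simp [cycleShift, Matrix.mulVec, dotProduct]

theorem cycleShift_transpose_mul_self : (cycleShift m R).transpose * cycleShift m R = 1 := by
  ext i j
  simp only [cycleShift, Matrix.mul_apply, Matrix.transpose_apply, Matrix.of_apply, Matrix.one_apply]
  rw [← Equiv.sum_comp (Equiv.subRight (1 : Fin (m + 1)))]
  simp [eq_comm (a := j)]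

/-- The shift is orthogonal, so expanding the right side leaves `-2 I + S + Sᵀ`. -/
theorem shiftMatrix_neg_two : shiftMatrix m (-2 : R) =
    -((1 - cycleShift m R).transpose * (1 - cycleShift m R)) := by
  rw [Matrix.transpose_sub, sub_mul, mul_sub, mul_sub, cycleShift_transpose_mul_self, shiftMatrix]
  ext i j
  simp
  ring

theorem sum_comp_add_one {M : Type*} [AddCommMonoid M] (f : Fin (m + 1) → M) :
    ∑ i, f (i + 1) = ∑ i, f i :=
  Equiv.sum_comp (Equiv.addRight (1 : Fin (m + 1))) f

theorem sum_sumZeroBasis (y : Fin m) : ∑ x, sumZeroBasis m R x y = 0 := by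
  simp [sumZeroBasis]

theorem sumZeroBasis_castSucc (y z : Fin m) :
    sumZeroBasis m R y.castSucc z = if y = z then 1 else 0 := by
  simp [sumZeroBasis, (Fin.castSucc_lt_last y).ne]

theorem sumZeroBasis_mulVec_castSucc (x : Fin m → R) (y : Fin m) :
    (sumZeroBasis m R).mulVec x y.castSucc = x y := by
  simp [Matrix.mulVec, dotProduct, sumZeroBasis_castSucc]

theorem sum_sumZeroBasis_mulVec (x : Fin m → R) : ∑ i, (sumZeroBasis m R).mulVec x i = 0 := by
  simp only [Matrix.mulVec, dotProduct]
  rw [Finset.sum_comm]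
  simp [← Finset.sum_mul, sum_sumZeroBasis]

theorem sum_shiftMatrix (a : R) (x : Fin (m + 1)) : ∑ y, shiftMatrix m a x y = a + 2 := by
  have h : ∑ y : Fin (m + 1), (if y + 1 = x then (1 : R) else 0) = 1 := by
    rw [sum_comp_add_one fun y => if y = x then (1 : R) else 0]
    simp
  simp [shiftMatrix, cycleShift, Finset.sum_add_distrib, Matrix.one_apply, h]
  ring

/-- Over a field in which `m + 1 ≠ 0`, the form `-2 I + S + Sᵀ` on the vectors with coordinate sum
zero is nondegenerate, and its determinant is in the square class of `m + 1` if `m` is even. -/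
theorem exists_det_sumZeroGram_neg_two {F : Type*} [Field F] (hm : Even m)
    (hn : ((m + 1 : ℕ) : F) ≠ 0) :
    ∃ d : F, d ≠ 0 ∧ (sumZeroGram m (-2 : F)).det * ((m + 1 : ℕ) : F) = d ^ 2 := by
  set K : Matrix (Fin (m + 1)) (Fin m) F := (1 - cycleShift m F) * sumZeroBasis m F with hK
  have hgram : sumZeroGram m (-2 : F) = -(K.transpose * K) := by
    rw [sumZeroGram, shiftMatrix_neg_two, hK, Matrix.transpose_mul]
    simp only [Matrix.mul_neg, Matrix.neg_mul, Matrix.mul_assoc]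
  have hKv : ∀ x i, K.mulVec x i = (sumZeroBasis m F).mulVec x i -
      (sumZeroBasis m F).mulVec x (i + 1) := by
    intro x i
    rw [hK, ← Matrix.mulVec_mulVec, Matrix.sub_mulVec, Matrix.one_mulVec, Pi.sub_apply,
      cycleShift_mulVec]
  have hsum : ∀ x, ∑ i, K.mulVec x i = 0 := by
    intro x
    simp only [hKv]
    rw [Finset.sum_sub_distrib, sum_comp_add_one, sub_self]
  have hcol : ∀ y, ∑ i, K i y = 0 := by
    intro y
    simpa using hsum (Pi.single y 1)
  -- The columns of `K` sum to zero, hence are orthogonal to the all-ones column. Adjoining it gives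
  -- a square matrix with `det(A)² = det(Kᵀ K) (m + 1)`.
  set A : Matrix (Fin (m + 1)) (Fin m ⊕ Unit) F :=
    Matrix.fromCols K (Matrix.replicateCol Unit fun _ => 1) with hA
  have hAA : A.transpose * A = Matrix.fromBlocks (K.transpose * K) 0 0
      (Matrix.of fun _ _ => ((m + 1 : ℕ) : F)) := by
    ext (i | i) (j | j) <;> simp [hA, Matrix.mul_apply, hcol]
  let e : Fin m ⊕ Unit ≃ Fin (m + 1) := Fintype.equivOfCardEq (by simp)
  have hE : (A.submatrix e id).transpose * A.submatrix e id = A.transpose * A := by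
    rw [Matrix.transpose_submatrix, Matrix.submatrix_mul_equiv]; rfl
  refine ⟨(A.submatrix e id).det, ?_, ?_⟩
  · intro h0
    obtain ⟨v, hv, h⟩ := Matrix.exists_mulVec_eq_zero_iff.mpr h0
    apply hv
    -- Summing all coordinates kills the all-ones coefficient, as `m + 1 ≠ 0`. The remaining vector
    -- is fixed by the shift, hence constant, and has sum zero, hence vanishes.
    have h1 : ∀ i, K.mulVec (v ∘ Sum.inl) i + v (Sum.inr ()) = 0 := by
      intro i
      have := congrFun h (e.symm i)
      simpa [hA, Matrix.mulVec, dotProduct, Fintype.sum_sum_type] using this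
    have h2 : v (Sum.inr ()) = 0 := by
      have := Finset.sum_congr rfl fun i (_ : i ∈ Finset.univ) => h1 i
      rw [Finset.sum_add_distrib, hsum] at this
      simpa [hn, Nat.cast_add_one_ne_zero, -Nat.cast_add] using this
    have h3 : ∀ i : Fin m, (sumZeroBasis m F).mulVec (v ∘ Sum.inl) i.castSucc =
        (sumZeroBasis m F).mulVec (v ∘ Sum.inl) i.succ := by
      intro i
      have := h1 i.castSucc
      rwa [h2, add_zero, hKv, Fin.coeSucc_eq_succ, sub_eq_zero] at this
    have h4 : ∀ i, (sumZeroBasis m F).mulVec (v ∘ Sum.inl) i =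
        (sumZeroBasis m F).mulVec (v ∘ Sum.inl) 0 := by
      intro i
      induction i using Fin.induction with
      | zero => rfl
      | succ i ih => rw [← h3, ih]
    have h5 := sum_sumZeroBasis_mulVec (R := F) (v ∘ Sum.inl)
    rw [Finset.sum_congr rfl fun i _ => h4 i] at h5
    simp only [Finset.sum_const, Finset.card_univ, Fintype.card_fin, nsmul_eq_mul, mul_eq_zero, hn,
      false_or] at h5
    ext (i | i)
    · have := sumZeroBasis_mulVec_castSucc (R := F) (v ∘ Sum.inl) i
      rw [h4, h5] at this
      exact this.symm
    · exact h2
  · have h1 := congrArg Matrix.det hE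
    rw [hAA, Matrix.det_mul, Matrix.det_transpose, Matrix.det_fromBlocks_zero₂₁,
      Matrix.det_unique (n := Unit)] at h1
    rw [hgram, Matrix.det_neg, Fintype.card_fin, hm.neg_one_pow, one_mul, sq, h1]
    rfl

theorem map_intCast_sumZeroGram (a : ℤ) :
    (sumZeroGram m a).map (fun z : ℤ => (z : R)) = sumZeroGram m (a : R) := by
  have h1 : (sumZeroBasis m ℤ).map (fun z : ℤ => (z : R)) = sumZeroBasis m R := by
    ext i j
    simp only [sumZeroBasis, Matrix.map_apply, Matrix.of_apply]
    push_cast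
    rfl
  have h2 : (shiftMatrix m a).map (fun z : ℤ => (z : R)) = shiftMatrix m (a : R) := by
    ext i j
    simp only [shiftMatrix, cycleShift, Matrix.map_apply, Matrix.add_apply, Matrix.smul_apply,
      Matrix.one_apply, Matrix.transpose_apply, Matrix.of_apply, smul_eq_mul]
    push_cast
    rfl
  rw [sumZeroGram, map_intCast_mul, map_intCast_mul, Matrix.transpose_map, h1, h2, sumZeroGram]

/-- Since `a ≡ -2` modulo `p`, the Gram matrix reduces to the one just computed over `ZMod p`. -/
theorem exists_dvd_det_sumZeroGram (p : ℕ) [Fact p.Prime] (hm : Even m) (hn : ¬ p ∣ m + 1) {a : ℤ}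
    (ha : (p : ℤ) ∣ a + 2) : ¬ (p : ℤ) ∣ (sumZeroGram m a).det ∧
      ∃ d : ℤ, (p : ℤ) ∣ (sumZeroGram m a).det * (m + 1 : ℕ) - d ^ 2 := by
  have hn' : ((m + 1 : ℕ) : ZMod p) ≠ 0 := by rwa [Ne, ZMod.natCast_eq_zero_iff]
  obtain ⟨d, hd, h⟩ := exists_det_sumZeroGram_neg_two (F := ZMod p) hm hn'
  have e : (((sumZeroGram m a).det : ℤ) : ZMod p) = (sumZeroGram m (-2 : ZMod p)).det := by
    rw [Int.cast_det, map_intCast_sumZeroGram]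
    congr 2
    rw [← ZMod.intCast_zmod_eq_zero_iff_dvd] at ha
    push_cast at ha
    exact eq_neg_of_add_eq_zero_left ha
  refine ⟨?_, (d.val : ℤ), ?_⟩
  · rw [← ZMod.intCast_zmod_eq_zero_iff_dvd, e]
    intro h0
    rw [h0, zero_mul] at h
    exact hd (pow_eq_zero_iff two_ne_zero |>.mp h.symm)
  · rw [← ZMod.intCast_zmod_eq_zero_iff_dvd]
    rw [Int.cast_sub, Int.cast_mul, e, Int.cast_pow, Int.cast_natCast, Int.cast_natCast,
      ZMod.natCast_zmod_val, h, sub_self]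

end Cycle

/-! ### The excess matrix of `t` cycles of the same length -/

section Excess

variable {m t : ℕ}

/-- The matrix `diag(B, …, B) + l J` with `t` blocks `B = a I + S + Sᵀ`. -/
def shiftBlockMatrix (m t : ℕ) (a l : ℚ) : Matrix (Fin t × Fin (m + 1)) (Fin t × Fin (m + 1)) ℚ :=
  Matrix.of fun u w => (if u.1 = w.1 then shiftMatrix m a u.2 w.2 else 0) + l

/-- For length 2 the shift equals its transpose, and the sum yields the double edge. Length 1 is
excluded: there the shift is the identity and would alter the diagonal. -/
theorem cycleMatrix_eq_shiftMatrix (hm : 0 < m) (a : ℚ) :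
    cycleMatrix (m + 1) a = shiftMatrix m a := by
  have hval : ∀ i j : Fin (m + 1), (i.val + 1) % (m + 1) = j.val ↔ i + 1 = j := by
    intro i j
    rw [Fin.ext_iff, Fin.val_add]
    simp
  ext i j
  simp only [cycleMatrix, cycleMult, hval, shiftMatrix, cycleShift, Matrix.of_apply,
    Matrix.add_apply, Matrix.smul_apply, Matrix.one_apply, Matrix.transpose_apply, smul_eq_mul]
  by_cases h : i = j
  · subst h
    have : i + 1 ≠ i := by
      intro h
      have h1 : (1 : Fin (m + 1)) = 0 := by simpa using h
      rw [Fin.ext_iff, Fin.val_one', Fin.val_zero, Nat.mod_eq_of_lt (by omega)] at h1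
      omega
    simp [this]
  · simp [h]

/-- Completing squares around the cycle makes positive definiteness for `a > 2` visible. -/
theorem shiftMatrix_quadratic (a : ℚ) (x : Fin (m + 1) → ℚ) :
    x ⬝ᵥ (shiftMatrix m a).mulVec x =
      (a - 2) * ∑ i, x i ^ 2 + ∑ i, (x i + x (i + 1)) ^ 2 := by
  have h1 : (shiftMatrix m a).mulVec x = a • x + (cycleShift m ℚ).mulVec x +
      (cycleShift m ℚ).transpose.mulVec x := by
    rw [shiftMatrix, Matrix.add_mulVec, Matrix.add_mulVec, Matrix.smul_mulVec, Matrix.one_mulVec]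
  have h2 : x ⬝ᵥ (cycleShift m ℚ).transpose.mulVec x = x ⬝ᵥ (cycleShift m ℚ).mulVec x := by
    rw [Matrix.dotProduct_mulVec, Matrix.vecMul_transpose, dotProduct_comm]
  have h3 : x ⬝ᵥ (cycleShift m ℚ).mulVec x = ∑ i, x i * x (i + 1) := by
    simp [dotProduct, cycleShift_mulVec]
  have h4 : x ⬝ᵥ (a • x) = a * ∑ i, x i ^ 2 := by
    rw [dotProduct_smul, smul_eq_mul, dotProduct]
    simp only [sq]
  have h5 : ∑ i, (x i + x (i + 1)) ^ 2 = 2 * ∑ i, x i ^ 2 + 2 * ∑ i, x i * x (i + 1) := by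
    rw [two_mul (∑ i, x i ^ 2)]
    nth_rewrite 2 [← sum_comp_add_one fun i => x i ^ 2]
    rw [Finset.mul_sum, ← Finset.sum_add_distrib, ← Finset.sum_add_distrib]
    exact Finset.sum_congr rfl fun i _ => by ring
  rw [h1, dotProduct_add, dotProduct_add, h2, h3, h4, h5]
  ring

theorem isAnisotropicMatrix_shiftBlockMatrix {a l : ℚ} (ha : 2 < a) (hl : 0 ≤ l) :
    IsAnisotropicMatrix (shiftBlockMatrix m t a l) where
  isSymm := by
    ext u w
    have := (shiftMatrix_isSymm (m := m) a).apply u.2 w.2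
    simp [shiftBlockMatrix, eq_comm (a := w.1), this]
  eq_zero x hx := by
    have e : x ⬝ᵥ (shiftBlockMatrix m t a l).mulVec x =
        ∑ i, (fun y => x (i, y)) ⬝ᵥ (shiftMatrix m a).mulVec (fun y => x (i, y)) +
          l * (∑ u, x u) ^ 2 := by
      have h1 : ∀ u, (shiftBlockMatrix m t a l).mulVec x u =
          (shiftMatrix m a).mulVec (fun y => x (u.1, y)) u.2 + l * ∑ w, x w := by
        intro u
        simp only [Matrix.mulVec, dotProduct, shiftBlockMatrix, Matrix.of_apply, add_mul,
          Finset.sum_add_distrib, ite_mul, zero_mul, Finset.mul_sum]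
        rw [Fintype.sum_prod_type]
        congr 1
        rw [Finset.sum_eq_single u.1 (fun j _ hj => by simp [hj.symm]) (by simp)]
        simp
      simp only [dotProduct, h1, mul_add, Finset.sum_add_distrib]
      rw [← Finset.sum_mul, Fintype.sum_prod_type]
      congr 1
      ring
    rw [e] at hx
    have h1 : ∀ i ∈ Finset.univ, 0 ≤
        (fun y => x (i, y)) ⬝ᵥ (shiftMatrix m a).mulVec (fun y => x (i, y)) := by
      intro i _
      rw [shiftMatrix_quadratic]
      have : 0 ≤ a - 2 := by linarith
      positivity
    have h2 : 0 ≤ l * (∑ u, x u) ^ 2 := by positivity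
    have h3 := (Finset.sum_eq_zero_iff_of_nonneg h1).mp
      (le_antisymm (by linarith) (Finset.sum_nonneg h1))
    ext ⟨i, y⟩
    have h4 := h3 i (Finset.mem_univ i)
    rw [shiftMatrix_quadratic] at h4
    have h5 : 0 ≤ ∑ y, (x (i, y) + x (i, y + 1)) ^ 2 := by positivity
    have h6 : 0 ≤ ∑ y, x (i, y) ^ 2 := by positivity
    have h7 : ∑ y, x (i, y) ^ 2 = 0 := by nlinarith
    have h8 := (Finset.sum_eq_zero_iff_of_nonneg (fun y _ => sq_nonneg (x (i, y)))).mp h7 y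
      (Finset.mem_univ y)
    simpa using h8

theorem matrixCongruent_shiftBlockMatrix_excessMatrix (hm : 0 < m) (k lam : ℕ) :
    MatrixCongruent (shiftBlockMatrix m t ((k : ℚ) - lam) lam)
      (excessMatrix k lam fun _ : Fin t => m + 1) := by
  let e : Fin (∑ _i : Fin t, (m + 1)) ≃ Fin t × Fin (m + 1) :=
    finSigmaFinEquiv.symm.trans (Equiv.sigmaEquivProd _ _)
  have h : excessMatrix k lam (fun _ : Fin t => m + 1) =
      (shiftBlockMatrix m t ((k : ℚ) - lam) lam).submatrix e e := by
    ext i j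
    simp only [excessMatrix, Matrix.add_apply, Matrix.reindex_apply, Matrix.submatrix_apply,
      Matrix.smul_apply, Matrix.of_apply, smul_eq_mul, mul_one, shiftBlockMatrix, e,
      Equiv.trans_apply]
    congr 1
    generalize finSigmaFinEquiv.symm i = u
    generalize finSigmaFinEquiv.symm j = w
    obtain ⟨u1, u2⟩ := u
    obtain ⟨w1, w2⟩ := w
    rw [Matrix.blockDiagonal'_apply]
    by_cases h : u1 = w1
    · subst h
      simp [cycleMatrix_eq_shiftMatrix hm]
    · simp [h]
  rw [h]
  exact MatrixCongruent.of_submatrix e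

/-- The Gram matrix of `t` copies of the sum-zero lattice. -/
def sumZeroBlockGram (m t : ℕ) (a : ℤ) : Matrix (Fin (t * m)) (Fin (t * m)) ℤ :=
  (Matrix.kroneckerMap (· * ·) (1 : Matrix (Fin t) (Fin t) ℤ) (sumZeroGram m a)).submatrix
    finProdFinEquiv.symm finProdFinEquiv.symm

theorem det_sumZeroBlockGram (a : ℤ) :
    (sumZeroBlockGram m t a).det = (sumZeroGram m a).det ^ t := by
  rw [sumZeroBlockGram, Matrix.det_submatrix_equiv_self, Matrix.det_kronecker]
  simp

theorem sumZeroBlockGram_isSymm (a : ℤ) : (sumZeroBlockGram m t a).IsSymm := by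
  rw [sumZeroBlockGram]
  refine Matrix.IsSymm.submatrix ?_ _
  ext i j
  have := (sumZeroGram_isSymm (m := m) a).apply i.2 j.2
  simp [Matrix.one_apply, this, eq_comm (a := j.1)]

/-- All row sums of a block are `a + 2`, so its all-ones vector is orthogonal to the sum-zero
vectors, on which `J` vanishes too. Two all-ones vectors of cycles pair to `l n²`, plus `n (a + 2)`
if they coincide. -/
theorem matrixCongruent_shiftBlockMatrix_directSumMatrix (a : ℤ) (l : ℚ) :
    MatrixCongruent (shiftBlockMatrix m t (a : ℚ) l)
      (directSumMatrix ((sumZeroBlockGram m t a).map fun z : ℤ => (z : ℚ))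
        (Matrix.of fun i j : Fin t =>
          (if i = j then ((m + 1 : ℕ) : ℚ) * (a + 2) else 0) + l * ((m + 1 : ℕ) : ℚ) ^ 2)) := by
  set n : ℚ := ((m + 1 : ℕ) : ℚ) with hn
  have hn0 : n ≠ 0 := by rw [hn]; positivity
  set Y : Matrix (Fin t) (Fin t) ℚ :=
    Matrix.of fun i j : Fin t => (if i = j then n * (a + 2) else 0) + l * n ^ 2 with hY
  set G : Matrix ((Fin t × Fin m) ⊕ Fin t) ((Fin t × Fin m) ⊕ Fin t) ℚ := Matrix.fromBlocks
    (Matrix.of fun u w => if u.1 = w.1 then sumZeroGram m (a : ℚ) u.2 w.2 else 0) 0 0 Y with hG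
  let e : Fin (t * m + t) ≃ (Fin t × Fin m) ⊕ Fin t :=
    finSumFinEquiv.symm.trans (Equiv.sumCongr finProdFinEquiv.symm (Equiv.refl _))
  have h1 : directSumMatrix ((sumZeroBlockGram m t a).map fun z : ℤ => (z : ℚ)) Y =
      G.submatrix e e := by
    ext i j
    simp only [directSumMatrix, Matrix.submatrix_apply, e, Equiv.trans_apply]
    generalize finSumFinEquiv.symm i = u
    generalize finSumFinEquiv.symm j = w
    rcases u with u | u <;> rcases w with w | w <;>
      simp [hG, sumZeroBlockGram, ← map_intCast_sumZeroGram, Matrix.one_apply]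
  rw [h1]
  refine MatrixCongruent.trans ?_ (MatrixCongruent.of_submatrix e)
  set P : Matrix (Fin t × Fin (m + 1)) ((Fin t × Fin m) ⊕ Fin t) ℚ :=
    Matrix.of fun u => Sum.elim (fun w => if u.1 = w.1 then sumZeroBasis m ℚ u.2 w.2 else 0)
      (fun j => if u.1 = j then 1 else 0) with hP
  -- Coordinates in the new basis: on each cycle the mean is the all-ones coefficient, and the first
  -- `m` entries minus the mean are the sum-zero coordinates.
  set Q : Matrix ((Fin t × Fin m) ⊕ Fin t) (Fin t × Fin (m + 1)) ℚ :=
    Matrix.of fun w u => Sum.elim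
      (fun w : Fin t × Fin m => if w.1 = u.1 then (if u.2 = w.2.castSucc then 1 else 0) - 1 / n
        else 0)
      (fun j => if j = u.1 then 1 / n else 0) w with hQ
  have hsplit : ∀ (i : Fin t) (f : Fin t × Fin (m + 1) → ℚ), (∀ j, j ≠ i → ∀ x, f (j, x) = 0) →
      ∑ u, f u = ∑ x, f (i, x) := by
    intro i f hf
    rw [Fintype.sum_prod_type]
    exact Finset.sum_eq_single i (fun j _ hj => Finset.sum_eq_zero fun x _ => hf j hj x) (by simp)
  have hQP : Q * P = 1 := by
    ext (⟨i, y⟩ | i) (⟨j, z⟩ | j)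
    · rw [Matrix.mul_apply, hsplit i _ fun k hk x => by simp [hQ, hk.symm]]
      by_cases hij : i = j
      · subst hij
        simp [hP, hQ, sub_mul, Finset.sum_sub_distrib, ← Finset.mul_sum, sum_sumZeroBasis,
          sumZeroBasis_castSucc, Matrix.one_apply]
      · simp [hP, hij]
    · rw [Matrix.mul_apply, hsplit i _ fun k hk x => by simp [hQ, hk.symm]]
      by_cases hij : i = j
      · subst hij
        simp [hP, hQ, Finset.sum_sub_distrib]
        rw [hn] at hn0 ⊢
        push_cast at hn0 ⊢
        rw [mul_inv_cancel₀ hn0, sub_self]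
      · simp [hP, hij]
    · rw [Matrix.mul_apply, hsplit i _ fun k hk x => by simp [hQ, hk.symm]]
      by_cases hij : i = j
      · subst hij
        simp [hP, hQ, ← Finset.mul_sum, sum_sumZeroBasis]
      · simp [hP, hij]
    · rw [Matrix.mul_apply, hsplit i _ fun k hk x => by simp [hQ, hk.symm]]
      by_cases hij : i = j
      · subst hij
        simp [hP, hQ]
        rw [hn] at hn0 ⊢
        push_cast at hn0 ⊢
        rw [mul_inv_cancel₀ hn0]
      · simp [hP, hij]
  have hPQ : P * Q = 1 := (Matrix.mul_eq_one_comm_of_card_eq _ _ _ (by simp; ring)).mp hQP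
  refine ⟨P, Q, hPQ, hQP, ?_⟩
  have hXl : ∀ u w, (shiftBlockMatrix m t (a : ℚ) l * P) u (Sum.inl w) =
      if u.1 = w.1 then (shiftMatrix m (a : ℚ) * sumZeroBasis m ℚ) u.2 w.2 else 0 := by
    intro u w
    rw [Matrix.mul_apply, hsplit w.1 _ fun k hk x => by simp [hP, hk]]
    by_cases h : u.1 = w.1
    · simp [hP, shiftBlockMatrix, h, add_mul, Finset.sum_add_distrib, ← Finset.mul_sum,
        sum_sumZeroBasis, Matrix.mul_apply]
    · simp [hP, shiftBlockMatrix, h, ← Finset.mul_sum, sum_sumZeroBasis]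
  have hXr : ∀ u j, (shiftBlockMatrix m t (a : ℚ) l * P) u (Sum.inr j) =
      (if u.1 = j then (a : ℚ) + 2 else 0) + l * n := by
    intro u j
    rw [Matrix.mul_apply, hsplit j _ fun k hk x => by simp [hP, hk]]
    by_cases h : u.1 = j
    · simp [hP, shiftBlockMatrix, h, Finset.sum_add_distrib, sum_shiftMatrix, hn, mul_comm]
    · simp [hP, shiftBlockMatrix, h, hn, mul_comm]
  rw [Matrix.mul_assoc]
  ext (⟨i, y⟩ | i) (⟨j, z⟩ | j)
  · rw [Matrix.mul_apply, hsplit i _ fun k hk x => by simp [hP, hk]]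
    simp only [hXl]
    by_cases hij : i = j
    · subst hij
      simp only [hP, hG, sumZeroGram, Matrix.mul_assoc, Matrix.transpose_apply, Matrix.of_apply,
        Sum.elim_inl, if_true, Matrix.fromBlocks_apply₁₁]
      rw [Matrix.mul_apply (M := (sumZeroBasis m ℚ).transpose)]
      rfl
    · simp [hG, hij]
  · rw [Matrix.mul_apply, hsplit i _ fun k hk x => by simp [hP, hk]]
    simp only [hXr]
    simp only [hP, Matrix.transpose_apply, Matrix.of_apply, Sum.elim_inl, if_true]
    change ∑ x, sumZeroBasis m ℚ x y * ((if i = j then (a : ℚ) + 2 else 0) + l * n) = 0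
    rw [← Finset.sum_mul, sum_sumZeroBasis, zero_mul]
  · rw [Matrix.mul_apply, hsplit i _ fun k hk x => by simp [hP, hk]]
    simp only [hXl]
    by_cases hij : i = j
    · subst hij
      simp only [hP, Matrix.transpose_apply, Matrix.of_apply, Sum.elim_inr, if_true, one_mul,
        Matrix.mul_apply]
      rw [Finset.sum_comm]
      have hs : ∀ y, ∑ x, shiftMatrix m (a : ℚ) x y = a + 2 := by
        intro y
        rw [← sum_shiftMatrix (a : ℚ) y]
        exact Finset.sum_congr rfl fun x _ => (shiftMatrix_isSymm _).apply y x
      simp [← Finset.sum_mul, hs, ← Finset.mul_sum, sum_sumZeroBasis, hG]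
    · simp [hG, hij]
  · rw [Matrix.mul_apply, hsplit i _ fun k hk x => by simp [hP, hk]]
    simp only [hXr]
    by_cases hij : i = j
    · subst hij
      simp [hP, hG, hY, hn]
      ring
    · simp [hP, hG, hY, hn, hij]
      ring

end Excess

/-! ### The invariant of the excess matrix -/

section Main

theorem excessMatrix_isAnisotropicMatrix {m t k lam : ℕ} (hm : 0 < m) (hk : lam + 2 < k) :
    IsAnisotropicMatrix (excessMatrix k lam fun _ : Fin t => m + 1) := by
  refine (matrixCongruent_shiftBlockMatrix_excessMatrix hm k lam).isAnisotropicMatrix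
    (isAnisotropicMatrix_shiftBlockMatrix ?_ (by positivity))
  have : ((lam + 2 : ℕ) : ℚ) < k := by exact_mod_cast hk
  push_cast at this
  linarith

theorem card_eq_sum_const (m t : ℕ) : t * m + t = ∑ _i : Fin t, (m + 1) := by
  simp [mul_add]

theorem mul_card_eq {v k l : ℚ} (hl : l ≠ 0) (hv : v = (k * (k - 1) - 2) / l + 1) :
    l * v = k * (k - 1) - 2 + l := by
  rw [hv]; field_simp

theorem hasseMinkowski_excessMatrix (p : ℕ) [Fact p.Prime] (hp2 : p ≠ 2) {m r k lam : ℕ}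
    (hm : 0 < m) (hme : Even m) (hlam : 0 < lam) (hk : lam + 2 < k)
    (hv : (((m + 1) * (2 * r + 1) : ℕ) : ℚ) = ((k : ℚ) * ((k : ℚ) - 1) - 2) / (lam : ℚ) + 1)
    (hpk : p ∣ k - lam + 2) (hpn : ¬ p ∣ m + 1) :
    hasseMinkowski p (excessMatrix k lam fun _ : Fin (2 * r + 1) => m + 1) =
      hilbertSym p ((k : ℚ) - lam + 2) ((-1) ^ r * ((m + 1 : ℕ) : ℚ) * lam) := by
  have hk' : ((lam + 2 : ℕ) : ℚ) < k := by exact_mod_cast hk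
  push_cast at hk'
  have hl0 : (lam : ℚ) ≠ 0 := by positivity
  have hn0 : ((m + 1 : ℕ) : ℚ) ≠ 0 := by positivity
  have hX : IsAnisotropicMatrix (shiftBlockMatrix m (2 * r + 1) ((k : ℚ) - lam) lam) :=
    isAnisotropicMatrix_shiftBlockMatrix (by linarith) (by positivity)
  have c1 := matrixCongruent_shiftBlockMatrix_excessMatrix (t := 2 * r + 1) hm k lam
  have c2 := matrixCongruent_shiftBlockMatrix_directSumMatrix (m := m) (t := 2 * r + 1)
    ((k : ℤ) - lam) (lam : ℚ)
  push_cast at c2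
  have hZ := c2.isAnisotropicMatrix hX
  have hpa : (p : ℤ) ∣ (k : ℤ) - lam + 2 := by
    have : ((k - lam + 2 : ℕ) : ℤ) = (k : ℤ) - lam + 2 := by omega
    rw [← this]
    exact_mod_cast hpk
  obtain ⟨hd, z, hz⟩ := exists_dvd_det_sumZeroGram p hme hpn hpa
  have hpp : Prime (p : ℤ) := Nat.prime_iff_prime_int.mp Fact.out
  have heq : hasseMinkowski p (excessMatrix k lam fun _ : Fin (2 * r + 1) => m + 1) =
      hasseMinkowski p _ := (c2.symm.trans c1).hasseMinkowski_eq p (card_eq_sum_const _ _) hZ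
  rw [heq]
  have hcast : ((m + 1 : ℕ) : ℚ) = (((m + 1 : ℕ) : ℤ) : ℚ) := by push_cast; rfl
  have hnt := mul_card_eq hl0 hv
  push_cast at hnt
  have h := hasseMinkowski_directSumMatrix_scalar_add_const p hp2 (r := r)
    (sumZeroBlockGram m (2 * r + 1) ((k : ℤ) - lam)) (sumZeroBlockGram_isSymm _)
    (by rw [det_sumZeroBlockGram]; exact fun h => hd (hpp.dvd_of_dvd_pow h))
    (n := ((m + 1 : ℕ) : ℤ)) (by exact_mod_cast hpn)
    -- With `D` the determinant for one cycle, the total is `D ^ (2 r + 1) = D (D ^ r) ^ 2`, so the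
    -- square witness is multiplied by `D ^ r`.
    (z := (sumZeroGram m ((k : ℤ) - lam)).det ^ r * z)
    (by
      rw [det_sumZeroBlockGram]
      refine Dvd.dvd.trans hz ⟨(sumZeroGram m ((k : ℤ) - lam)).det ^ (2 * r), by ring⟩)
    (a := (k : ℚ) - lam + 2) (l := lam) (e := lam * ((m + 1 : ℕ) : ℚ) ^ 2) (k := k)
    (u := ((m + 1 : ℕ) : ℚ)) (by linarith) hl0 hn0 rfl (by linarith)
    -- The counting condition says `k - λ + 2 + λ n t = k²`; this is `n` times it.
    (by push_cast; linear_combination ((m : ℚ) + 1) * hnt)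
    (fun j _ => by
      have : (0 : ℚ) < (k : ℚ) - lam + 2 := by linarith
      push_cast
      positivity)
    (by simpa using hZ)
  simpa using h

/-- The invariant of the excess matrix in terms of Legendre symbols. -/
theorem hasseMinkowski_excessMatrix_eq_legendreSym (p : ℕ) [Fact p.Prime] (hp2 : p ≠ 2)
    {m r k lam : ℕ} (hm : 0 < m) (hme : Even m) (hlam : 0 < lam) (hk : lam + 2 < k)
    (hv : (((m + 1) * (2 * r + 1) : ℕ) : ℚ) = ((k : ℚ) * ((k : ℚ) - 1) - 2) / (lam : ℚ) + 1)
    (hpk : p ∣ k - lam + 2) (hpn : ¬ p ∣ m + 1) {s α lbar γ : ℕ}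
    (hs : k - lam + 2 = s * p ^ α) (hps : ¬ p ∣ s) (hl : lam = lbar * p ^ γ) (hpl : ¬ p ∣ lbar) :
    hasseMinkowski p (excessMatrix k lam fun _ : Fin (2 * r + 1) => m + 1) =
      legendreSym p (-1) ^ (α * γ) * legendreSym p s ^ γ *
        legendreSym p ((-1) ^ r * (m + 1 : ℕ) * lbar) ^ α := by
  rw [hasseMinkowski_excessMatrix p hp2 hm hme hlam hk hv hpk hpn]
  have hA : (k : ℚ) - lam + 2 = (((p : ℤ) ^ α * s : ℤ) : ℚ) := by
    have : ((k - lam + 2 : ℕ) : ℤ) = (k : ℤ) - lam + 2 := by omega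
    rw [hs] at this
    push_cast at this
    rw [mul_comm ((p : ℤ) ^ α), this]
    push_cast
    ring
  have hB : (-1 : ℚ) ^ r * ((m + 1 : ℕ) : ℚ) * lam =
      (((p : ℤ) ^ γ * ((-1) ^ r * (m + 1 : ℕ) * lbar) : ℤ) : ℚ) := by
    rw [hl]
    push_cast
    ring
  rw [hA, hB, hilbertSym_intCast, hilbertSymInt_pow_mul]
  · exact_mod_cast hps
  · refine not_dvd_mul p (not_dvd_mul p ?_ (by exact_mod_cast hpn)) (by exact_mod_cast hpl)
    exact fun h => not_dvd_neg_one p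
      ((Nat.prime_iff_prime_int.mp Fact.out).dvd_of_dvd_pow h)

/-! ### Coverings -/

/-- Double counting: each block through `x` contributes its `k` points, `x` itself included. -/
theorem sum_pairCount {V : Type*} [Fintype V] [DecidableEq V] {k : ℕ} (B : Multiset (Finset V))
    (hB : ∀ b ∈ B, b.card = k) (x : V) : ∑ y, pairCount B x y = k * pairCount B x x := by
  induction B using Multiset.induction_on with
  | empty => simp [pairCount]
  | cons b B ih =>
    have h := ih fun c hc => hB c (Multiset.mem_cons_of_mem hc)
    have hb := hB b (Multiset.mem_cons_self b B)
    simp only [pairCount, Multiset.countP_cons, Finset.sum_add_distrib] at h ⊢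
    rw [h, mul_add]
    congr 1
    by_cases hx : x ∈ b <;> simp [hx, hb]

theorem pairCount_eq_sum {V : Type*} [DecidableEq V] (B : Multiset (Finset V)) (x y : V) :
    (pairCount B x y : ℚ) = ∑ j : Fin B.toList.length,
      (if x ∈ B.toList.get j then (1 : ℚ) else 0) * if y ∈ B.toList.get j then 1 else 0 := by
  have h : ∀ L : List (Finset V), (pairCount (L : Multiset (Finset V)) x y : ℚ) =
      ∑ j : Fin L.length, (if x ∈ L.get j then (1 : ℚ) else 0) * if y ∈ L.get j then 1 else 0 := by
    intro L
    induction L with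
    | nil => simp [pairCount]
    | cons b L ih =>
      rw [← Multiset.cons_coe, pairCount, Multiset.countP_cons, Nat.cast_add, add_comm]
      simp only [List.length_cons]
      rw [Fin.sum_univ_succ]
      congr 1
      by_cases hx : x ∈ b <;> by_cases hy : y ∈ b <;> simp [hx, hy]
  conv_lhs => rw [← B.coe_toList]
  exact h _

theorem hasseMinkowski_one (p : ℕ) [Fact p.Prime] (n : ℕ) :
    hasseMinkowski p (1 : Matrix (Fin n) (Fin n) ℚ) = 1 := by
  have h : ∀ i, leadingMinor (1 : Matrix (Fin n) (Fin n) ℚ) i = 1 := by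
    intro i
    rw [leadingMinor, ← Matrix.det_one (n := {j : Fin n // j.val < i}) (R := ℚ)]
    congr 1
    ext a b
    simp [Matrix.toSquareBlockProp_def, Matrix.one_apply, Subtype.ext_iff]
  have h1 : hilbertSym p (-1) (-1) = 1 := by
    simpa using hilbertSym_eq_one_of_not_dvd p (not_dvd_neg_one p) (not_dvd_neg_one p)
  simp [hasseMinkowski, h, h1, hilbertSym_one_left p (y := -1) (by norm_num)]

theorem isAnisotropicMatrix_one (n : ℕ) : IsAnisotropicMatrix (1 : Matrix (Fin n) (Fin n) ℚ) where
  isSymm := Matrix.transpose_one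
  eq_zero x hx := by rwa [Matrix.one_mulVec, dotProduct_self_eq_zero] at hx

/-- The excess matrix of a symmetric covering with cycle excess is `N Nᵀ` for the incidence
matrix `N`. -/
theorem shiftBlockMatrix_eq_pairCount {m t k lam : ℕ} (hm : 0 < m) (hk : lam + 2 < k)
    (hlam : 0 < lam)
    (hv : (((m + 1) * t : ℕ) : ℚ) = ((k : ℚ) * ((k : ℚ) - 1) - 2) / (lam : ℚ) + 1)
    {V : Type*} [Fintype V] [DecidableEq V] {B : Multiset (Finset V)}
    (hB : IsSymmetricCovering ((m + 1) * t) k lam B)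
    (e : ((_ : Fin t) × Fin (m + 1)) ≃ V)
    (h1 : ∀ (i : Fin t) (x y : Fin (m + 1)), x ≠ y →
      excessMult lam B (e ⟨i, x⟩) (e ⟨i, y⟩) = cycleMult (m + 1) x y)
    (h2 : ∀ (i j : Fin t) (x y : Fin (m + 1)), i ≠ j →
      excessMult lam B (e ⟨i, x⟩) (e ⟨j, y⟩) = 0) (u w : Fin t × Fin (m + 1)) :
    shiftBlockMatrix m t ((k : ℚ) - lam) lam u w =
      pairCount B (e ⟨u.1, u.2⟩) (e ⟨w.1, w.2⟩) := by
  have hl0 : (lam : ℚ) ≠ 0 := by positivity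
  have hoff : ∀ u w : Fin t × Fin (m + 1), u ≠ w →
      shiftBlockMatrix m t ((k : ℚ) - lam) lam u w =
        pairCount B (e ⟨u.1, u.2⟩) (e ⟨w.1, w.2⟩) := by
    rintro ⟨i, x⟩ ⟨j, y⟩ hne
    have hle := hB.le_pairCount (e ⟨i, x⟩) (e ⟨j, y⟩) (fun h => hne (by
      have := e.injective h
      simp only [Sigma.mk.injEq, heq_eq_eq] at this
      rw [this.1, this.2]))
    have hex : (pairCount B (e ⟨i, x⟩) (e ⟨j, y⟩) : ℚ) =
        excessMult lam B (e ⟨i, x⟩) (e ⟨j, y⟩) + lam := by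
      rw [excessMult]
      push_cast [hle]
      ring
    simp only [shiftBlockMatrix, Matrix.of_apply]
    rw [hex]
    by_cases hij : i = j
    · subst hij
      have hxy : x ≠ y := fun h => hne (by rw [h])
      rw [h1 i x y hxy, ← cycleMatrix_eq_shiftMatrix hm]
      simp [cycleMatrix, hxy]
    · rw [h2 i j x y hij]
      simp [hij]
  by_cases huw : u ≠ w
  · exact hoff u w huw
  rw [not_not] at huw
  subst huw
  let e' : Fin t × Fin (m + 1) ≃ V := (Equiv.sigmaEquivProd _ _).symm.trans e
  have hdiag : shiftBlockMatrix m t ((k : ℚ) - lam) lam u u = k := by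
    simp [shiftBlockMatrix, ← cycleMatrix_eq_shiftMatrix hm, cycleMatrix]
  -- It is not assumed that each point lies in `k` blocks. The row sum is `k²` and the off-diagonal
  -- entries are pair counts, so the number `ρ` of blocks through the point satisfies `k² - k = k ρ
  -- - ρ`, whence `ρ = k`.
  have hrow : ∑ w, shiftBlockMatrix m t ((k : ℚ) - lam) lam u w = k ^ 2 := by
    have := mul_card_eq hl0 hv
    push_cast at this
    simp only [shiftBlockMatrix, Matrix.of_apply, Finset.sum_add_distrib]
    rw [Fintype.sum_prod_type, Finset.sum_eq_single u.1 (fun j _ hj => by simp [hj.symm]) (by simp)]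
    simp only [if_true, sum_shiftMatrix]
    simp
    linear_combination this
  have hsum : ∑ w : Fin t × Fin (m + 1), (pairCount B (e ⟨u.1, u.2⟩) (e ⟨w.1, w.2⟩) : ℚ) =
      k * pairCount B (e ⟨u.1, u.2⟩) (e ⟨u.1, u.2⟩) := by
    have := sum_pairCount B hB.card_block (e ⟨u.1, u.2⟩)
    rw [← Equiv.sum_comp e'] at this
    exact_mod_cast this
  rw [← Finset.add_sum_erase _ _ (Finset.mem_univ u)] at hrow hsum
  rw [Finset.sum_congr rfl fun w hw => hoff u w (Finset.ne_of_mem_erase hw).symm] at hrow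
  rw [hdiag] at hrow ⊢
  have hk1 : (k : ℚ) - 1 ≠ 0 := by
    have : ((lam + 2 : ℕ) : ℚ) < k := by exact_mod_cast hk
    push_cast at this
    have : (0 : ℚ) ≤ lam := by positivity
    exact ne_of_gt (by linarith)
  apply mul_left_cancel₀ hk1
  linear_combination hsum - hrow

theorem hasseMinkowski_eq_one_of_covering (p : ℕ) [Fact p.Prime] {m t k lam : ℕ} (hm : 0 < m)
    (hk : lam + 2 < k) (hlam : 0 < lam)
    (hv : (((m + 1) * t : ℕ) : ℚ) = ((k : ℚ) * ((k : ℚ) - 1) - 2) / (lam : ℚ) + 1)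
    {V : Type*} [Fintype V] [DecidableEq V] {B : Multiset (Finset V)}
    (hB : IsSymmetricCovering ((m + 1) * t) k lam B)
    (hE : ExcessHasCycleType lam B fun _ : Fin t => m + 1) :
    hasseMinkowski p (excessMatrix k lam fun _ : Fin t => m + 1) = 1 := by
  obtain ⟨-, e, h1, h2⟩ := hE
  have hpc := shiftBlockMatrix_eq_pairCount hm hk hlam hv hB e h1 h2
  have hk' : ((lam + 2 : ℕ) : ℚ) < k := by exact_mod_cast hk
  push_cast at hk'
  have hX : IsAnisotropicMatrix (shiftBlockMatrix m t ((k : ℚ) - lam) lam) :=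
    isAnisotropicMatrix_shiftBlockMatrix (by linarith) (by positivity)
  have hlen : B.toList.length = t * m + t := by
    rw [Multiset.length_toList, hB.card_blocks, hB.card_points]
    ring
  have c1 := matrixCongruent_shiftBlockMatrix_excessMatrix (t := t) hm k lam
  let N : Matrix (Fin t × Fin (m + 1)) (Fin B.toList.length) ℚ :=
    Matrix.of fun u j => if e ⟨u.1, u.2⟩ ∈ B.toList.get j then 1 else 0
  have hN : shiftBlockMatrix m t ((k : ℚ) - lam) lam = N * N.transpose := by
    ext u w
    rw [hpc, pairCount_eq_sum, Matrix.mul_apply]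
    rfl
  have c0 : MatrixCongruent (1 : Matrix (Fin B.toList.length) (Fin B.toList.length) ℚ)
      (shiftBlockMatrix m t ((k : ℚ) - lam) lam) := by
    have hQP : (shiftBlockMatrix m t ((k : ℚ) - lam) lam)⁻¹ * N * N.transpose = 1 := by
      rw [Matrix.mul_assoc, ← hN]
      exact Matrix.nonsing_inv_mul _ (isUnit_iff_ne_zero.mpr hX.det_ne_zero)
    -- The change of basis is `Nᵀ`, with left inverse `X⁻¹ N` because `N Nᵀ = X`; it is two-sided
    -- since there are as many blocks as points.
    refine ⟨N.transpose, (shiftBlockMatrix m t ((k : ℚ) - lam) lam)⁻¹ * N, ?_, hQP, ?_⟩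
    · refine (Matrix.mul_eq_one_comm_of_card_eq _ _ _ ?_).mp hQP
      simp only [Fintype.card_prod, Fintype.card_fin, hlen]
      ring
    · rw [Matrix.transpose_transpose, Matrix.mul_one, hN]
  have := (c0.trans c1).hasseMinkowski_eq p (hlen.trans (card_eq_sum_const m t))
    (isAnisotropicMatrix_one _)
  rw [this, hasseMinkowski_one]

end Main

/-! ### Comparison of the invariant with the three conditions -/

theorem mainTheorem3 (n t k lam : ℕ)
    (hn : 0 < n) (ht : 0 < t) (hlam : 0 < lam) (hk : lam + 2 < k)
    (hv : ((n * t : ℕ) : ℚ) = ((k : ℚ) * ((k : ℚ) - 1) - 2) / (lam : ℚ) + 1)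
    (hodd : Odd (n * t))
    (p : ℕ) [Fact p.Prime] (hp2 : p ≠ 2)
    (hpk : p ∣ k - lam + 2) (hpn : ¬ p ∣ n)
    (s α lbar γ : ℕ)
    (hs : k - lam + 2 = s * p ^ α) (hps : ¬ p ∣ s)
    (hl : lam = lbar * p ^ γ) (hpl : ¬ p ∣ lbar) :
    ((Even α ∧ Odd γ ∧ legendreSym p (s : ℤ) = -1 ∨
      Odd α ∧ Even γ ∧
        legendreSym p ((-1 : ℤ) ^ ((t - 1) / 2) * (n : ℤ) * (lbar : ℤ)) = -1 ∨
      Odd α ∧ Odd γ ∧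
        legendreSym p ((-1 : ℤ) ^ ((t + 1) / 2) * (n : ℤ) * (s : ℤ) * (lbar : ℤ)) = -1) →
      ∀ (V : Type*) [Fintype V] [DecidableEq V],
        ¬ ∃ B : Multiset (Finset V),
          IsSymmetricCovering (n * t) k lam B ∧ ExcessHasCycleType lam B (fun _ : Fin t => n)) ∧
    (¬ (Even α ∧ Odd γ ∧ legendreSym p (s : ℤ) = -1 ∨
      Odd α ∧ Even γ ∧
        legendreSym p ((-1 : ℤ) ^ ((t - 1) / 2) * (n : ℤ) * (lbar : ℤ)) = -1 ∨
      Odd α ∧ Odd γ ∧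
        legendreSym p ((-1 : ℤ) ^ ((t + 1) / 2) * (n : ℤ) * (s : ℤ) * (lbar : ℤ)) = -1) →
      2 ≤ n →
        IsNondegenerateMatrix (excessMatrix k lam (fun _ : Fin t => n)) ∧
          hasseMinkowski p (excessMatrix k lam (fun _ : Fin t => n)) = 1) := by
  obtain ⟨hno, ⟨r, rfl⟩⟩ := Nat.odd_mul.mp hodd
  obtain ⟨m, rfl⟩ : ∃ m, n = m + 1 := ⟨n - 1, by omega⟩
  have hme : Even m := by
    rw [Nat.odd_add_one, Nat.not_odd_iff_even] at hno
    exact hno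
  have h1 : (2 * r + 1 - 1) / 2 = r := by omega
  have h2 : (2 * r + 1 + 1) / 2 = r + 1 := by omega
  rw [h1, h2]
  set x := legendreSym p (-1) with hx
  set y := legendreSym p s with hy
  set z := legendreSym p ((-1) ^ r * ((m + 1 : ℕ) : ℤ) * (lbar : ℤ)) with hz
  -- The symbol in the third condition is the product of the other two and `(-1 / p)`. All three
  -- conditions thereby become statements that `x ^ (α γ) y ^ γ z ^ α = -1` for given parities; for
  -- `α`, `γ` both even the value is 1.
  have hzx : legendreSym p ((-1) ^ (r + 1) * ((m + 1 : ℕ) : ℤ) * (s : ℤ) * (lbar : ℤ)) =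
      x * y * z := by
    rw [hx, hy, hz, ← legendreSym.mul, ← legendreSym.mul]
    congr 1
    ring
  rw [hzx]
  have hx2 : x ^ 2 = 1 := legendreSym_sq_eq_one p (not_dvd_neg_one p)
  have hy2 : y ^ 2 = 1 := legendreSym_sq_eq_one p (by exact_mod_cast hps)
  have hz2 : z ^ 2 = 1 := by
    refine legendreSym_sq_eq_one p (not_dvd_mul p (not_dvd_mul p ?_ (by exact_mod_cast hpn))
      (by exact_mod_cast hpl))
    exact fun h => not_dvd_neg_one p ((Nat.prime_iff_prime_int.mp Fact.out).dvd_of_dvd_pow h)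
  have hev : ∀ {x : ℤ}, x ^ 2 = 1 → ∀ {j : ℕ}, Even j → x ^ j = 1 := by
    rintro x hx j ⟨i, rfl⟩
    rw [← two_mul, pow_two_mul_eq_one hx]
  have hod : ∀ {x : ℤ}, x ^ 2 = 1 → ∀ {j : ℕ}, Odd j → x ^ j = x := by
    rintro x hx j ⟨i, rfl⟩
    rw [pow_succ, pow_two_mul_eq_one hx, one_mul]
  have hxyz : (x * y * z) ^ 2 = 1 := by rw [mul_pow, mul_pow, hx2, hy2, hz2]; rfl
  have hone : ∀ {x : ℤ}, x ^ 2 = 1 → x ≠ -1 → x = 1 := fun h h' =>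
    ((sq_eq_sq_iff_eq_or_eq_neg.mp (h.trans (one_pow 2).symm))).resolve_right h'
  have hval : 0 < m → hasseMinkowski p (excessMatrix k lam fun _ : Fin (2 * r + 1) => m + 1) =
      x ^ (α * γ) * y ^ γ * z ^ α := fun hm =>
    hasseMinkowski_excessMatrix_eq_legendreSym p hp2 hm hme hlam hk hv hpk hpn hs hps hl hpl
  refine ⟨?_, ?_⟩
  · rintro hc V _ _ ⟨B, hB, hE⟩
    -- For `n = 1` there is nothing to exclude, since cycles have length at least 2.
    have hm : 0 < m := by
      have : 2 ≤ m + 1 := hE.1 ⟨0, by omega⟩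
      omega
    have h := hasseMinkowski_eq_one_of_covering p hm hk hlam hv hB hE
    rw [hval hm] at h
    rcases hc with ⟨ha, hg, hc⟩ | ⟨ha, hg, hc⟩ | ⟨ha, hg, hc⟩
    · rw [hev hx2 (ha.mul_right γ), hev hz2 ha, hod hy2 hg, hc] at h
      norm_num at h
    · rw [hev hx2 (hg.mul_left α), hod hz2 ha, hev hy2 hg, hc] at h
      norm_num at h
    · rw [hod hx2 (ha.mul hg), hod hz2 ha, hod hy2 hg, hc] at h
      norm_num at h
  · intro hc hn2
    have hm : 0 < m := by omega
    refine ⟨fun i _ => (excessMatrix_isAnisotropicMatrix hm hk).leadingMinor_ne_zero i, ?_⟩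
    rw [hval hm]
    push Not at hc
    obtain ⟨c1, c2, c3⟩ := hc
    rcases Nat.even_or_odd α with ha | ha <;> rcases Nat.even_or_odd γ with hg | hg
    · rw [hev hx2 (ha.mul_right γ), hev hz2 ha, hev hy2 hg]
      rfl
    · rw [hev hx2 (ha.mul_right γ), hev hz2 ha, hod hy2 hg, hone hy2 (c1 ha hg)]
      rfl
    · rw [hev hx2 (hg.mul_left α), hod hz2 ha, hev hy2 hg, hone hz2 (c2 ha hg)]
      rfl
    · rw [hod hx2 (ha.mul hg), hod hz2 ha, hod hy2 hg, hone hxyz (c3 ha hg)]
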